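/- Consider the synchronous randomized $\mathsf{CONGEST}$ model. The network is a connected, undirected, unweighted, simple graph $G$ with $n$ nodes, of diameter $D$ (the largest eccentricity) and radius $r$ (the smallest eccentricity), where the eccentricity of a node is its largest distance to a node. The nodes carry distinct identifiers from $\{0,\dots,n^a-1\}$ for a constant $a$. Initially every node knows $n$, its own identifier, the identifiers of its neighbours, and private independent fair random bits. In each round it can send a possibly different message of $O(\log n)$ bits to each of its neighbours, and local computation is free. All nodes run the same algorithm. A node halts when it produces its output. There is an absolute constant $\kappa$ such that for every integer $k\ge 1$ and all constants $a,c\ge 0$ there is a randomized $\mathsf{CONGEST}$ algorithm with the following properties on every such network. 1. All nodes halt within $\tilde O\big(n^{1/(k+1)}+D\big)$ rounds, that is, within $C\,\big(n^{1/(k+1)}+D\big)\,(1+\log n)^{e}$ rounds. Here $C$, $e$, and the constant in the $O(\log n)$ bound on the message size, depend only on $k$, $a$, $c$. 2. With probability at least $1-n^{-c}$, there are integers $\hat D,\hat r\ge 0$ that all nodes output, and every node $v$ also outputs an integer $\hat e(v)\ge 0$, such that $$\hat D\le D\le\Big(2-\frac1{2^k}\Big)\hat D+\kappa,\qquad \hat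 r\le r\le\Big(2-\frac1{2^k}\Big)\hat r+\kappa,$$ and, for every node $v$, $$\hat e(v)\le ecc(v)\le\Big(3-\frac4{2^k+1}\Big)\hat e(v)+\kappa .$$ -/

import Mathlib

/-!
The synchronous `CONGEST` model with private randomness, and approximation of distance
parameters in it.
-/

namespace Congest

/-- A connected, undirected, unweighted, simple network on `n` nodes. The nodes carry pairwise
distinct identifiers below `n ^ a`, i.e. identifiers of `O(log n)` bits. -/
structure Network (n a : ℕ) where
  graph : SimpleGraph (Fin n)
  connected : graph.Connected
  ident : Fin n → ℕ
  ident_injective : Function.Injective ident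
  ident_lt : ∀ v, ident v < n ^ a

/-- The words of `O(log n)` bits (with constant `β`) that can be sent over an edge in a round. -/
abbrev Message (β n : ℕ) : Type := Fin (β * (Nat.log 2 n + 1)) → Bool

/-- A randomized distributed algorithm whose nodes produce outputs of type `Out`. All nodes run the
same code and know the number `n` of nodes; local computation is not restricted. -/
structure Algorithm (Out : Type) where
  /-- the constant in the `O(log n)` bound on the number of bits of a message -/
  bandwidth : ℕ
  /-- the number of private random bits of each node, in networks of `n` nodes -/
  coins : ℕ → ℕ
  /-- the possible local states of a node, in networks of `n` nodes -/
  State : ℕ → Type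
  /-- the initial state, from the node's own identifier, the set of the identifiers of its
  neighbours, and its private random bits -/
  init : (n : ℕ) → ℕ → Set ℕ → (Fin (coins n) → Bool) → State n
  /-- the message (if any) that a node in the given state sends to its neighbour with the given
  identifier -/
  send : (n : ℕ) → State n → ℕ → Option (Message bandwidth n)
  /-- the new state, from the old one and the set of all pairs (identifier of a neighbour, message
  received from this neighbour in this round) -/
  receive : (n : ℕ) → State n → Set (ℕ × Message bandwidth n) → State n
  /-- the final output; a node halts as soon as it is in a state with an output -/
  output : (n : ℕ) → State n → Option Out

namespace Algorithm

variable {Out : Type} {n a : ℕ}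

/-- The random bits of all nodes of a network with `n` nodes. -/
abbrev Coins (A : Algorithm Out) (n : ℕ) : Type := Fin n → Fin (A.coins n) → Bool

/-- What node `u` sends to its neighbour `v` when it is in state `s`: nodes that have halted are
silent. -/
def sent (A : Algorithm Out) (N : Network n a) (s : A.State n) (v : Fin n) :
    Option (Message A.bandwidth n) :=
  match A.output n s with
  | none => A.send n s (N.ident v)
  | some _ => none

/-- The messages that reach node `v` in a round at whose start the states are `σ`. -/
def inbox (A : Algorithm Out) (N : Network n a) (σ : Fin n → A.State n) (v : Fin n) :
    Set (ℕ × Message A.bandwidth n) :=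
  {p | ∃ u, N.graph.Adj v u ∧ N.ident u = p.1 ∧ A.sent N (σ u) v = some p.2}

/-- One synchronous round: the states of nodes that have halted do not change any more. -/
def round (A : Algorithm Out) (N : Network n a) (σ : Fin n → A.State n) : Fin n → A.State n :=
  fun v =>
    match A.output n (σ v) with
    | none => A.receive n (σ v) (A.inbox N σ v)
    | some _ => σ v

/-- The states of all nodes after `t` rounds on the network `N` with random bits `ω`. -/
def run (A : Algorithm Out) (N : Network n a) (ω : A.Coins n) : ℕ → Fin n → A.State n
  | 0 => fun v => A.init n (N.ident v) (N.ident '' {u | N.graph.Adj v u}) (ω v)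
  | t + 1 => A.round N (A.run N ω t)

/-- The output of node `v` if it has halted within `t` rounds, and `none` otherwise. -/
def outputAt (A : Algorithm Out) (N : Network n a) (ω : A.Coins n) (t : ℕ) (v : Fin n) :
    Option Out :=
  A.output n (A.run N ω t v)

/-- Node `v` of `N` halts with output `o` in the execution with random bits `ω`. -/
def Outputs (A : Algorithm Out) (N : Network n a) (ω : A.Coins n) (v : Fin n) (o : Out) : Prop :=
  ∃ t, A.outputAt N ω t v = some o

/-- All nodes of `N` halt within `T` rounds, whatever the random bits are. -/
def HaltsWithin (A : Algorithm Out) (N : Network n a) (T : ℝ) : Prop :=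
  ∃ t : ℕ, (t : ℝ) ≤ T ∧ ∀ (ω : A.Coins n) (v : Fin n), ∃ o, A.outputAt N ω t v = some o

/-- The probability of the event `E` when all random bits of all nodes are independent and
unbiased. -/
noncomputable def prob (A : Algorithm Out) (E : Set (A.Coins n)) : ℝ :=
  (E.ncard : ℝ) / Nat.card (A.Coins n)

end Algorithm

/-- What a node outputs: estimates of the diameter and of the radius of the network, and of its
own eccentricity. -/
structure Estimate where
  diam : ℕ
  radius : ℕ
  ecc : ℕ

/-- `est` approximates the quantity `x` from below, with multiplicative factor `α` and additive
error `κ`. -/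
def Approximates (α κ : ℝ) (est x : ℕ) : Prop :=
  est ≤ x ∧ (x : ℝ) ≤ α * est + κ

/-- In the execution with random bits `ω`, the nodes output a common estimate of the diameter and a
common estimate of the radius that are `α`-approximations, and every node outputs an
`α'`-approximation of its own eccentricity; all this up to the additive error `κ`. (Networks are
connected, so the values that are converted to natural numbers are finite.) -/
def Succeeds {n a : ℕ} (A : Algorithm Estimate) (N : Network n a) (ω : A.Coins n)
    (α α' κ : ℝ) : Prop :=
  ∃ (d r : ℕ) (e : Fin n → ℕ),
    (∀ v, A.Outputs N ω v ⟨d, r, e v⟩) ∧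
    Approximates α κ d N.graph.diam ∧
    Approximates α κ r N.graph.radius.toNat ∧
    ∀ v, Approximates α' κ (e v) (N.graph.eccent v).toNat

end Congest

/-! Random nested samples V = S_0 ⊇ S_1 ⊇ ... ⊇ S_k thin out by a factor q of order n^(1/(k+1)) per
level. Let h_i be the largest distance to S_i (truncated at n), attained at w_i. The skeleton S
consists of S_k, the nodes w_(i+1), and the nodes of S_i in the open ball of radius h_(i+1) about
w_(i+1), for i < k. That ball misses S_(i+1), so with high probability it has Õ(q^(i+1)) nodes, of
which Õ(q) lie in S_i. Hence S has Õ(q) nodes.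

Suppose the distances from v to S lie between m and R = m + x. After h_(i+1) - h_i - 1 steps from
w_(i+1) towards v, the S_i-node nearest to the current point still lies in the ball, hence in S. So
m ≤ h_i + R - (h_(i+1) - h_i - 1), that is, h_(i+1) ≤ 2 h_i + x + 1. By iteration h_k + (x + 1) ≤
2^k (x + 1), up to a truncation for paths that are too short (`Skeleton.min_add_le`). If m is the
least distance, then m ≤ h_k, so some skeleton node is within (1 - 2^(-k))(R + 1) of v. For v an end
of a diametral path or a centre, the triangle inequality gives the factor 2 - 2^(-k). For
eccentricities, bounds by h_k and by 2m on the error are combined.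

The skeleton and its distances are computed by pipelined source detection: distances to K labels
take D + K rounds (`detectState_eq`), and the same schedule run backwards collects eccentricities
(`echoState_eq`). As D is unknown, guesses Δ = 2^i are tried. A deterministic test accepts every Δ ≥
D, is unanimous, and implies D ≤ 2Δ when passed (`Passes.diam_le`, `Passes.all`). Running times
therefore do not depend on the coins; only the quality of the estimates does. -/

namespace Congest

/-! ### Broadcast programs and their composition -/

/-- Code of a node that broadcasts messages from `M` and finally returns an element of `O`. -/
inductive Prog (M O : Type) : Type
  /-- halt with the given output -/
  | ret : O → Prog M O
  /-- broadcast a message, and continue according to the set of received messages -/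
  | step : Option M → (Set M → Prog M O) → Prog M O

namespace Prog

variable {M O O' V S : Type}

/-- Sequential composition. -/
def bind : Prog M O → (O → Prog M O') → Prog M O'
  | ret o, f => f o
  | step m k, f => step m fun I => (k I).bind f

/-- The message broadcast in the next round. -/
def msg : Prog M O → Option M
  | ret _ => none
  | step m _ => m

/-- The rest of the code after a round in which the messages `I` arrive. -/
def next : Prog M O → Set M → Prog M O
  | ret o, _ => ret o
  | step _ k, I => k I

/-- The output, if the code has halted. -/
def out : Prog M O → Option O
  | ret o => some o
  | step _ _ => none

/-- The messages that reach `v` when every node `u` broadcasts `f u`. -/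
def heard (G : SimpleGraph V) (f : V → Option M) (v : V) : Set M :=
  {m | ∃ u, G.Adj v u ∧ f u = some m}

/-- One synchronous round. -/
def round (G : SimpleGraph V) (P : V → Prog M O) : V → Prog M O :=
  fun v => (P v).next (heard G (fun u => (P u).msg) v)

/-- The programs `P` of the nodes all return after exactly `T` rounds, with results `o`. -/
def Computes (G : SimpleGraph V) (T : ℕ) (P : V → Prog M O) (o : V → O) : Prop :=
  ∀ (O' : Type) (k : V → O → Prog M O'),
    (round G)^[T] (fun v => (P v).bind (k v)) = fun v => k v (o v)

theorem computes_ret (G : SimpleGraph V) (o : V → O) :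
    Computes G 0 (fun v => (ret (o v) : Prog M O)) o := fun _ _ => rfl

theorem bind_assoc {O'' : Type} (P : Prog M O) (f : O → Prog M O') (g : O' → Prog M O'') :
    (P.bind f).bind g = P.bind fun o => (f o).bind g := by
  induction P with
  | ret o => rfl
  | step m k ih => simp only [bind, ih]

theorem bind_ret (P : Prog M O) : P.bind ret = P := by
  induction P with
  | ret o => rfl
  | step m k ih => simp only [bind, ih]

/-- Since `Computes` quantifies over all continuations, the second program followed by `k` serves as
a continuation of the first. All nodes finish a phase in the same round, so phases never overlap. -/
theorem Computes.bind {G : SimpleGraph V} {T T' : ℕ} {P : V → Prog M O} {o : V → O}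
    {Q : V → O → Prog M O'} {o' : V → O'} (hP : Computes G T P o)
    (hQ : Computes G T' (fun v => Q v (o v)) o') :
    Computes G (T + T') (fun v => (P v).bind (Q v)) o' := by
  intro O'' k
  simp only [bind_assoc]
  rw [Nat.add_comm, Function.iterate_add_apply, hP, hQ]

theorem Computes.iterate_round {G : SimpleGraph V} {T : ℕ} {P : V → Prog M O} {o : V → O}
    (hP : Computes G T P o) : (round G)^[T] P = fun v => ret (o v) := by
  simpa only [bind_ret] using hP O fun _ => ret

/-- Repeat `T` rounds of sending and receiving, numbered from `t`. -/
def loop (send : ℕ → S → Option M) (recv : S → Set M → S) : ℕ → ℕ → S → Prog M S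
  | 0, _, s => ret s
  | T + 1, t, s => step (send t s) fun I => loop send recv T (t + 1) (recv s I)

/-- The states of the nodes after `T` rounds of `loop`. -/
def loopState (G : SimpleGraph V) (send : ℕ → S → Option M) (recv : S → Set M → S) (σ : V → S) :
    ℕ → V → S
  | 0 => σ
  | t + 1 => fun v => recv (loopState G send recv σ t v)
      (heard G (fun u => send t (loopState G send recv σ t u)) v)

theorem computes_loop (G : SimpleGraph V) (send : ℕ → S → Option M) (recv : S → Set M → S)
    (σ : V → S) (T : ℕ) :
    Computes G T (fun v => loop send recv T 0 (σ v)) (loopState G send recv σ T) := by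
  intro O' k
  -- The starting round is arbitrary because `send` sees the round number.
  have key : ∀ (T t : ℕ),
      (round G)^[T] (fun v => (loop send recv T t (loopState G send recv σ t v)).bind (k v)) =
        fun v => k v (loopState G send recv σ (T + t) v) := by
    intro T
    induction T with
    | zero => intro t; simp only [Nat.zero_add]; rfl
    | succ T ih =>
      intro t
      rw [Function.iterate_succ_apply]
      have h : round G (fun v =>
          (loop send recv (T + 1) t (loopState G send recv σ t v)).bind (k v)) =
          fun v => (loop send recv T (t + 1) (loopState G send recv σ (t + 1) v)).bind (k v) := rfl
      rw [h, ih, Nat.add_right_comm, Nat.add_assoc]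
  exact key T 0

end Prog

/-! ### Broadcast programs as `CONGEST` algorithms -/

/-- The algorithm whose nodes execute a program that depends on `n`, the own identifier and the
own random bits. The messages of the program are encoded by binary words. -/
def progAlgorithm {O : Type} (β : ℕ) (coins : ℕ → ℕ) (M : ℕ → Type)
    (enc : ∀ n, M n → Message β n) (P : ∀ n, ℕ → (Fin (coins n) → Bool) → Prog (M n) O) :
    Algorithm O where
  bandwidth := β
  coins := coins
  State n := Prog (M n) O
  init n i _ x := P n i x
  send n s _ := s.msg.map (enc n)
  receive n s I := s.next {m | ∃ i, (i, enc n m) ∈ I}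
  output _ s := s.out

/-- Programs use only the set of received messages, so senders can be forgotten, and injectivity of
the encoding recovers this set. The silence of halted nodes agrees with `msg` being `none` on `ret`.
-/
theorem progAlgorithm_round {O : Type} {β : ℕ} {coins : ℕ → ℕ} {M : ℕ → Type}
    {enc : ∀ n, M n → Message β n} (henc : ∀ n, Function.Injective (enc n))
    {P : ∀ n, ℕ → (Fin (coins n) → Bool) → Prog (M n) O} {n a : ℕ} (N : Network n a)
    (σ : Fin n → Prog (M n) O) :
    (progAlgorithm β coins M enc P).round N σ = Prog.round N.graph σ := by
  set A := progAlgorithm β coins M enc P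
  have hsent : ∀ u v, A.sent N (σ u) v = (Prog.msg (σ u)).map (enc n) := by
    intro u v
    unfold Algorithm.sent
    change (match Prog.out (σ u) with
      | none => (Prog.msg (σ u)).map (enc n)
      | some _ => none) = _
    generalize σ u = s
    cases s <;> rfl
  have hin : ∀ v, {m | ∃ i, (i, enc n m) ∈ A.inbox N σ v} =
      Prog.heard N.graph (fun u => Prog.msg (σ u)) v := by
    intro v
    ext m
    constructor
    · rintro ⟨i, u, hu, -, h⟩
      rw [hsent] at h
      obtain ⟨m', hm', he⟩ := Option.map_eq_some_iff.1 h
      exact ⟨u, hu, hm'.trans (congrArg some (henc n he))⟩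
    · rintro ⟨u, hu, h⟩
      refine ⟨N.ident u, u, hu, rfl, ?_⟩
      rw [hsent]
      exact Option.map_eq_some_iff.2 ⟨m, h, rfl⟩
  funext v
  unfold Prog.round
  rw [← hin v]
  unfold Algorithm.round
  change (match Prog.out (σ v) with
      | none => Prog.next (σ v) {m | ∃ i, (i, enc n m) ∈ A.inbox N σ v}
      | some _ => σ v) = _
  generalize A.inbox N σ v = I
  generalize σ v = s
  cases s <;> rfl

theorem progAlgorithm_run {O : Type} {β : ℕ} {coins : ℕ → ℕ} {M : ℕ → Type}
    {enc : ∀ n, M n → Message β n} (henc : ∀ n, Function.Injective (enc n))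
    {P : ∀ n, ℕ → (Fin (coins n) → Bool) → Prog (M n) O} {n a : ℕ} (N : Network n a)
    (ω : (progAlgorithm β coins M enc P).Coins n) (t : ℕ) :
    (progAlgorithm β coins M enc P).run N ω t =
      (Prog.round N.graph)^[t] fun v => P n (N.ident v) (ω v) := by
  induction t with
  | zero => rfl
  | succ t ih =>
    rw [Function.iterate_succ_apply', ← ih]
    exact progAlgorithm_round henc N _


/-! ### Distances to nodes and to labels -/

section Graph

variable {V : Type} {G : SimpleGraph V}

theorem dist_le_of_adj (hG : G.Connected) {u v : V} (h : G.Adj u v) (x : V) :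
    G.dist x u ≤ G.dist x v + 1 := by
  have := hG.dist_triangle (u := x) (v := v) (w := u)
  rwa [SimpleGraph.dist_eq_one_iff_adj.2 h.symm] at this

theorem exists_between (hG : G.Connected) {w v : V} {a b : ℕ} (h : G.dist w v = a + b) :
    ∃ y, G.dist w y = a ∧ G.dist y v = b := by
  obtain ⟨p, hp⟩ := hG.exists_walk_length_eq_dist w v
  refine ⟨p.getVert a, ?_⟩
  have h1 : G.dist w (p.getVert a) ≤ a :=
    (SimpleGraph.dist_le (p.take a)).trans (by simp [SimpleGraph.Walk.take_length])
  have h2 : G.dist (p.getVert a) v ≤ b :=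
    (SimpleGraph.dist_le (p.drop a)).trans (by simp [SimpleGraph.Walk.drop_length]; omega)
  have := hG.dist_triangle (u := w) (v := p.getVert a) (w := v)
  omega

theorem exists_adj_dist (hG : G.Connected) {x u : V} {j : ℕ} (h : G.dist x u = j + 1) :
    ∃ u', G.Adj u u' ∧ G.dist x u' = j := by
  obtain ⟨y, hy, hy'⟩ := exists_between hG h
  exact ⟨y, (SimpleGraph.dist_eq_one_iff_adj.1 hy').symm, hy⟩

theorem exists_near (hG : G.Connected) {w v : V} {R s : ℕ} (h : G.dist w v ≤ R) (hs : s ≤ R) :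
    ∃ y, G.dist w y ≤ s ∧ G.dist y v ≤ R - s := by
  rcases le_total (G.dist w v) s with h' | h'
  · exact ⟨v, h', by rw [SimpleGraph.dist_self]; exact Nat.zero_le _⟩
  · obtain ⟨y, hy, hy'⟩ := exists_between hG (w := w) (v := v) (a := s) (b := G.dist w v - s) (by omega)
    exact ⟨y, hy.le, by rw [hy']; omega⟩

theorem dist_le_diam [Finite V] (hG : G.Connected) (u v : V) : G.dist u v ≤ G.diam := by
  have := hG.nonempty
  exact SimpleGraph.dist_le_diam (SimpleGraph.connected_iff_ediam_ne_top.1 hG)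

theorem dist_lt_card {n : ℕ} {G : SimpleGraph (Fin n)} (hG : G.Connected) (u v : Fin n) :
    G.dist u v < n := by
  obtain ⟨p, hp, hl⟩ := hG.exists_path_of_dist u v
  rw [← hl]
  simpa using hp.length_lt

/-- The distance from `v` to the nearest node that carries the label `l`. -/
noncomputable def labelDist {L : Type} (G : SimpleGraph V) (src : V → Set L) (v : V) (l : L) : ℕ∞ :=
  ⨅ u, ⨅ _ : l ∈ src u, (G.dist v u : ℕ∞)

variable {L : Type} {src : V → Set L}

theorem labelDist_le {u : V} {l : L} (h : l ∈ src u) (v : V) :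
    labelDist G src v l ≤ G.dist v u := iInf₂_le u h

theorem exists_labelDist {v : V} {l : L} (h : labelDist G src v l ≠ ⊤) :
    ∃ u, l ∈ src u ∧ labelDist G src v l = G.dist v u := by
  have hne : {d : ℕ∞ | ∃ u, l ∈ src u ∧ (G.dist v u : ℕ∞) = d}.Nonempty := by
    by_contra hc
    rw [Set.not_nonempty_iff_eq_empty] at hc
    apply h
    refine iInf₂_eq_top.2 fun u hu => ?_
    have : (G.dist v u : ℕ∞) ∈ {d : ℕ∞ | ∃ u, l ∈ src u ∧ (G.dist v u : ℕ∞) = d} := ⟨u, hu, rfl⟩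
    rw [hc] at this
    exact this.elim
  obtain ⟨u, hu, he⟩ := csInf_mem hne
  refine ⟨u, hu, le_antisymm (labelDist_le hu v) ?_⟩
  rw [he]
  exact le_iInf₂ fun u' hu' => sInf_le ⟨u', hu', rfl⟩

theorem labelDist_adj (hG : G.Connected) {u v : V} (h : G.Adj v u) (l : L) :
    labelDist G src v l ≤ labelDist G src u l + 1 := by
  by_cases ht : labelDist G src u l = ⊤
  · simp [ht]
  obtain ⟨x, hx, he⟩ := exists_labelDist ht
  rw [he]
  refine (labelDist_le hx v).trans ?_
  rw [SimpleGraph.dist_comm, G.dist_comm (u := u)]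
  exact_mod_cast dist_le_of_adj hG h x

theorem exists_adj_labelDist (hG : G.Connected) {v : V} {l : L} {d : ℕ}
    (h : labelDist G src v l = (d + 1 : ℕ)) : ∃ u, G.Adj v u ∧ labelDist G src u l = d := by
  obtain ⟨x, hx, he⟩ := exists_labelDist (G := G) (src := src) (v := v) (l := l) (by simp [h])
  rw [h] at he
  have he' : G.dist x v = d + 1 := by rw [SimpleGraph.dist_comm]; exact_mod_cast he.symm
  obtain ⟨u, hu, hd⟩ := exists_adj_dist hG he'
  refine ⟨u, hu, le_antisymm ?_ ?_⟩
  · rw [← hd, SimpleGraph.dist_comm]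
    exact labelDist_le hx u
  · have := labelDist_adj (src := src) hG hu l
    rw [h] at this
    push_cast at this
    exact (ENat.add_le_add_iff_right (by simp)).1 this

theorem labelDist_eq_zero (hG : G.Connected) {v : V} {l : L} :
    labelDist G src v l = 0 ↔ l ∈ src v := by
  constructor
  · intro h
    obtain ⟨x, hx, he⟩ := exists_labelDist (G := G) (src := src) (v := v) (l := l) (by simp [h])
    rw [h] at he
    have : G.dist v x = 0 := by exact_mod_cast he.symm
    rwa [hG.dist_eq_zero_iff.1 this]
  · intro h
    have := labelDist_le (G := G) h v
    simpa using this

theorem labelDist_eq_top {v : V} {l : L} :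
    labelDist G src v l = ⊤ ↔ ∀ u, l ∉ src u := by
  constructor
  · intro h u hu
    have := labelDist_le (G := G) hu v
    rw [h] at this
    simp at this
  · intro h
    by_contra hc
    obtain ⟨u, hu, -⟩ := exists_labelDist hc
    exact h u hu

end Graph

/-- The messages of the programs: two numbers below `B` and a vector of `r` numbers below `B`. -/
abbrev Msg (B r : ℕ) : Type := Fin B × Fin B × (Fin r → Fin B)

open Prog

/-! ### Flooding of maxima -/

section Flood

variable {V : Type} {G : SimpleGraph V} {B r : ℕ} [NeZero B]

/-- Compute the supremum of the vectors of all nodes at distance at most `T`. -/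
noncomputable def flood (T : ℕ) (x : Fin r → Fin B) : Prog (Msg B r) (Fin r → Fin B) :=
  loop (fun _ s => some (0, 0, s)) (fun s I => s ⊔ ⨆ m ∈ I, m.2.2) T 0 x

theorem computes_flood (hG : G.Connected) (T : ℕ) (x : V → Fin r → Fin B) :
    Computes G T (fun v => flood T (x v)) fun v => ⨆ u, ⨆ _ : G.dist v u ≤ T, x u := by
  have h := computes_loop G (fun _ s => some ((0, 0, s) : Msg B r))
    (fun s I => s ⊔ ⨆ m ∈ I, m.2.2) x T
  have he : loopState G (fun _ s => some ((0, 0, s) : Msg B r))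
    (fun s I => s ⊔ ⨆ m ∈ I, m.2.2) x T = fun v => ⨆ u, ⨆ _ : G.dist v u ≤ T, x u := ?_
  · rwa [he] at h
  clear h
  induction T with
  | zero =>
    funext v
    simp [loopState, hG.dist_eq_zero_iff]
  | succ T ih =>
    funext v
    simp only [loopState]
    rw [ih]
    apply le_antisymm
    rotate_left
    · refine iSup₂_le fun u hu => ?_
      rcases Nat.lt_or_eq_of_le hu with hlt | heq
      · exact le_sup_of_le_left (le_iSup₂_of_le u (Nat.le_of_lt_succ hlt) le_rfl)
      · rw [SimpleGraph.dist_comm] at heq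
        obtain ⟨w, hw, hd⟩ := exists_adj_dist hG heq
        refine le_sup_of_le_right ?_
        refine le_iSup₂_of_le (0, 0, _) ⟨w, hw, rfl⟩ ?_
        exact le_iSup₂_of_le u (by rw [SimpleGraph.dist_comm, hd]) le_rfl
    · refine sup_le ?_ ?_
      · exact iSup₂_le fun u hu => le_iSup₂_of_le u (by omega) le_rfl
      · refine iSup₂_le fun m hm => ?_
        obtain ⟨w, hw, rfl⟩ : ∃ w, G.Adj v w ∧
          ((0, 0, ⨆ u, ⨆ _ : G.dist w u ≤ T, x u) : Msg B r) = m := by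
            obtain ⟨w, hw, he⟩ := hm
            exact ⟨w, hw, Option.some.inj he⟩
        refine iSup₂_le fun u hu => le_iSup₂_of_le u ?_ le_rfl
        have := dist_le_of_adj hG hw u
        rw [G.dist_comm (u := v), G.dist_comm (u := w)] at *
        omega

end Flood

/-! ### Pipelined source detection and its reversal -/

section Detect

variable {V : Type} {G : SimpleGraph V} {B r : ℕ}

/-- The labels that come before `l` when labels are sorted by their estimated distances. -/
def before (est : Fin B → ℕ∞) (l : Fin B) : Set (Fin B) :=
  {l' | est l' < est l ∨ est l' = est l ∧ l' < l}

/-- The round in which the distance `d` to the label `l` is due to be sent is `d` plus the position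
of `l` in the list of labels. -/
def Due (est : Fin B → ℕ∞) (t : ℕ) (p : Fin B × Fin B) : Prop :=
  est p.1 = (p.2 : ℕ) ∧ (p.2 : ℕ) + (before est p.1).ncard = t

theorem before_ssubset {est : Fin B → ℕ∞} {l l' : Fin B} (h : l' ∈ before est l) :
    before est l' ⊂ before est l := by
  have hs : before est l' ⊆ before est l := by
    rintro x (hx | ⟨hx, hx'⟩) <;> rcases h with h | ⟨h, h'⟩
    · exact Or.inl (hx.trans h)
    · exact Or.inl (hx.trans_eq h)
    · exact Or.inl (hx.trans_lt h)
    · exact Or.inr ⟨hx.trans h, hx'.trans h'⟩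
  refine hs.ssubset_of_mem_notMem h ?_
  rintro (h | ⟨-, h⟩) <;> exact absurd h (lt_irrefl _)

/-- Distance plus rank is strictly increasing in the lexicographic order of (distance, label), so
one message per round suffices. -/
theorem Due.eq {est : Fin B → ℕ∞} {t : ℕ} {p q : Fin B × Fin B} (hp : Due est t p)
    (hq : Due est t q) : p = q := by
  have key : ∀ {p q : Fin B × Fin B}, Due est t p → Due est t q → p.1 ∉ before est q.1 := by
    intro p q hp hq h
    have h1 := Set.ncard_lt_ncard (before_ssubset h) (Set.toFinite _)
    have h2 : (p.2 : ℕ) ≤ q.2 := by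
      have : est p.1 ≤ est q.1 := by
        rcases h with h | h
        · exact h.le
        · exact h.1.le
      rw [hp.1, hq.1] at this
      exact_mod_cast this
    have h3 := hp.2
    have h4 := hq.2
    omega
  have h1 := key hp hq
  have h2 := key hq hp
  simp only [before, Set.mem_ofPred_eq, not_or, not_lt, not_and] at h1 h2
  have he : est p.1 = est q.1 := le_antisymm h2.1 h1.1
  have hl : p.1 = q.1 := le_antisymm (h2.2 he.symm) (h1.2 he)
  refine Prod.ext hl (Fin.ext ?_)
  have := hp.1.symm.trans (he.trans hq.1)
  exact_mod_cast this

open Classical in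
/-- The entry that is due at time `t`. -/
noncomputable def due (est : Fin B → ℕ∞) (t : ℕ) : Option (Fin B × Fin B) :=
  if h : ∃ p, Due est t p then some h.choose else none

theorem due_eq_some {est : Fin B → ℕ∞} {t : ℕ} {p : Fin B × Fin B} :
    due est t = some p ↔ Due est t p := by
  unfold due
  constructor
  · intro h
    split_ifs at h with hp
    · rw [← Option.some.inj h]
      exact hp.choose_spec
  · intro h
    have hp : ∃ p, Due est t p := ⟨p, h⟩
    rw [dif_pos hp, hp.choose_spec.eq h]

/-- From `u` to `v` every distance grows by at most one, and that of `l` by exactly one, so no label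
that precedes `l` at `u` falls behind it at `v`. Hence `l` is due at `v` at least one round later
than at `u`, which is what makes pipelining work. -/
theorem before_subset_of_adj (hG : G.Connected) {src : V → Set (Fin B)} {u v : V} {l : Fin B}
    {d : ℕ} (h : G.Adj v u) (hv : labelDist G src v l = (d + 1 : ℕ))
    (hu : labelDist G src u l = d) :
    before (labelDist G src u) l ⊆ before (labelDist G src v) l := by
  have hle : ∀ x, labelDist G src v x ≤ labelDist G src u x + 1 := labelDist_adj hG h
  have hvl : labelDist G src v l = labelDist G src u l + 1 := by rw [hv, hu]; rfl
  rintro x (hx | ⟨hx, hx'⟩)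
  · refine Or.inl ((hle x).trans_lt ?_)
    rw [hvl]
    exact (ENat.add_lt_add_iff_right (by simp)).2 hx
  · have := hle x
    rw [hx, ← hvl] at this
    rcases this.lt_or_eq with h' | h'
    · exact Or.inl h'
    · exact Or.inr ⟨h', hx'⟩

variable {src : V → Set (Fin B)}

/-- A number of rounds that suffices for `detect`. -/
structure Enough (G : SimpleGraph V) (src : V → Set (Fin B)) (T : ℕ) : Prop where
  lt : ∀ v u l, l ∈ src u → G.dist v u < B
  le : ∀ v l (d : ℕ), labelDist G src v l = d → d + (before (labelDist G src v) l).ncard ≤ T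

theorem enough_of_card [Finite V] (hG : G.Connected) {K T : ℕ} (hK : {l | ∃ u, l ∈ src u}.ncard ≤ K)
    (hB : ∀ v u, G.dist v u < B) (hT : G.diam + K ≤ T) : Enough G src T where
  lt v u _ _ := hB v u
  le v l d h := by
    have h1 : (before (labelDist G src v) l) ⊆ {l | ∃ u, l ∈ src u} := by
      intro x hx
      have hne : labelDist G src v x ≠ ⊤ := by
        rcases hx with hx | hx
        · exact hx.ne_top
        · rw [hx.1, h]; simp
      obtain ⟨u, hu, -⟩ := exists_labelDist hne
      exact ⟨u, hu⟩
    have h2 := Set.ncard_le_ncard h1 (Set.toFinite _)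
    obtain ⟨u, hu, he⟩ := exists_labelDist (G := G) (src := src) (v := v) (l := l) (by simp [h])
    have h3 : d = G.dist v u := by rw [h] at he; exact_mod_cast he
    have h4 := dist_le_diam hG v u
    omega

variable [NeZero B]

/-- The states of `detect`. -/
noncomputable def detectRecv (est : Fin B → ℕ∞) (I : Set (Msg B r)) : Fin B → ℕ∞ :=
  fun l => est l ⊓ ⨅ m ∈ I, ⨅ _ : m.1 = l, ((m.2.1 : ℕ) + 1 : ℕ∞)

open Classical in
/-- Compute the distances to the labels: `src` are the labels of this node. -/
noncomputable def detect (T : ℕ) (src : Set (Fin B)) : Prog (Msg B r) (Fin B → ℕ∞) :=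
  loop (fun t est => (due est t).map fun p => (p.1, p.2, ⊥)) detectRecv T 0
    fun l => if l ∈ src then 0 else ⊤

open Classical in
/-- The results of `detect`. -/
noncomputable def detectState (r : ℕ) (G : SimpleGraph V) (src : V → Set (Fin B)) (T : ℕ) :
    V → Fin B → ℕ∞ :=
  loopState G (fun t est => (due est t).map fun p => ((p.1, p.2, ⊥) : Msg B r)) detectRecv
    (fun v l => if l ∈ src v then 0 else ⊤) T

theorem computes_detect (T : ℕ) (src : V → Set (Fin B)) :
    Computes G T (fun v => (detect T (src v) : Prog (Msg B r) _)) (detectState r G src T) :=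
  computes_loop G _ _ _ T

theorem detectState_antitone (v : V) (l : Fin B) :
    Antitone fun t => detectState r G src t v l :=
  antitone_nat_of_succ_le fun _ => inf_le_left

theorem labelDist_le_detectState (hG : G.Connected) (t : ℕ) (v : V) (l : Fin B) :
    labelDist G src v l ≤ detectState r G src t v l := by
  induction t generalizing v with
  | zero =>
    by_cases h : l ∈ src v
    · rw [(labelDist_eq_zero hG).2 h]; exact bot_le
    · simp [detectState, loopState, h]
  | succ t ih =>
    refine le_inf (ih v) (le_iInf₂ fun m hm => le_iInf fun hl => ?_)
    obtain ⟨u, hu, hs⟩ := hm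
    obtain ⟨p, hp, rfl⟩ := Option.map_eq_some_iff.1 hs
    subst hl
    have hd := (due_eq_some.1 hp).1
    refine (labelDist_adj hG hu _).trans ?_
    have := ih u
    change labelDist G src u p.1 + 1 ≤ ((p.2 : ℕ) : ℕ∞) + 1
    gcongr
    rw [← hd]
    exact this

/-- Induction on time. Let `u` be a neighbour one step nearer to `l`. At the round `s` when `l` is
truly due there, `u` knows its distances to `l` and to all labels before `l`. Estimates never drop
below true distances, so no wrong estimate moves a label ahead of `l`. Thus `u` announces `l` in
round `s`, in time for `v`. -/
theorem detectState_eq (hG : G.Connected) (hsrc : ∀ v u l, l ∈ src u → G.dist v u < B) {t : ℕ}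
    {v : V} {l : Fin B} {d : ℕ} (hd : labelDist G src v l = d)
    (ht : d + (before (labelDist G src v) l).ncard ≤ t) :
    detectState r G src t v l = d := by
  induction t using Nat.strong_induction_on generalizing v l d with
  | _ t ih =>
  refine le_antisymm ?_ (hd ▸ labelDist_le_detectState hG t v l)
  rcases d with _ | d
  · refine (detectState_antitone v l (Nat.zero_le t)).trans ?_
    simp [detectState, loopState, (labelDist_eq_zero hG).1 hd]
  obtain ⟨u, hu, hud⟩ := exists_adj_labelDist hG hd
  have hb := Set.ncard_le_ncard (before_subset_of_adj hG hu hd hud) (Set.toFinite _)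
  set s := d + (before (labelDist G src u) l).ncard with hs
  have hst : s < t := by omega
  have hsl : detectState r G src s u l = d := ih s hst hud le_rfl
  have hdB : d < B := by
    obtain ⟨x, hx, he⟩ := exists_labelDist (G := G) (src := src) (v := u) (l := l) (by simp [hud])
    rw [hud] at he
    have he' : d = G.dist u x := by exact_mod_cast he
    rw [he']
    exact hsrc u x l hx
  have hbe : before (detectState r G src s u) l = before (labelDist G src u) l := by
    have hfwd : before (labelDist G src u) l ⊆ before (detectState r G src s u) l := by
      intro x hx
      have hxd : labelDist G src u x ≤ d := by
        rcases hx with hx | hx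
        · exact hx.le.trans_eq hud
        · exact (hx.1.trans hud).le
      obtain ⟨e, he⟩ := ENat.ne_top_iff_exists.1 (ne_top_of_le_ne_top (ENat.natCast_ne_top d) hxd)
      have hed : e ≤ d := by rw [← he] at hxd; exact_mod_cast hxd
      have h1 := Set.ncard_le_ncard (before_ssubset hx).subset (Set.toFinite _)
      have h2 := ih s hst he.symm (by omega)
      rw [he] at h2
      unfold before at hx ⊢
      simp only [Set.mem_ofPred_eq] at hx ⊢
      rw [h2, hsl, ← hud]
      exact hx
    refine Set.Subset.antisymm ?_ hfwd
    intro x hx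
    have h1 := labelDist_le_detectState (r := r) (src := src) hG s u x
    unfold before at hx ⊢
    simp only [Set.mem_ofPred_eq] at hx ⊢
    rw [hsl, ← hud] at hx
    rcases hx with hx | ⟨hx, hx'⟩
    · exact Or.inl (h1.trans_lt hx)
    · rcases (h1.trans_eq hx).lt_or_eq with h | h
      · exact Or.inl h
      · exact Or.inr ⟨h, hx'⟩
  have hdue : due (detectState r G src s u) s = some (l, ⟨d, hdB⟩) :=
    due_eq_some.2 ⟨hsl, by rw [hbe]⟩
  refine (detectState_antitone v l (show s + 1 ≤ t from hst)).trans ?_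
  refine inf_le_right.trans ?_
  refine iInf₂_le_of_le (l, ⟨d, hdB⟩, ⊥) ⟨u, hu, ?_⟩ (iInf_le_of_le rfl ?_)
  · exact Option.map_eq_some_iff.2 ⟨_, hdue, rfl⟩
  · simp

theorem detectState_eq_labelDist (hG : G.Connected) {T : ℕ} (h : Enough G src T) :
    detectState r G src T = labelDist G src := by
  funext v l
  by_cases ht : labelDist G src v l = ⊤
  · rw [ht]
    exact top_le_iff.1 (ht ▸ labelDist_le_detectState hG T v l)
  · obtain ⟨d, hd⟩ := ENat.ne_top_iff_exists.1 ht
    rw [← hd]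
    exact detectState_eq hG h.lt hd.symm (h.le v l d hd.symm)

/-- The state update of `echo`. -/
noncomputable def echoRecv (A : Fin B → Fin B) (I : Set (Msg B r)) : Fin B → Fin B :=
  fun l => A l ⊔ ⨆ m ∈ I, ⨆ _ : m.1 = l, m.2.1

/-- Run `detect` backwards to send the suprema of the values `A l` towards the sources of `l`. -/
noncomputable def echo (T : ℕ) (est : Fin B → ℕ∞) (A : Fin B → Fin B) :
    Prog (Msg B r) (Fin B → Fin B) :=
  (loop (fun t (s : (Fin B → ℕ∞) × (Fin B → Fin B)) =>
    (due s.1 (T - t)).map fun p => (p.1, s.2 p.1, ⊥)) (fun s I => (s.1, echoRecv s.2 I)) T 0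
    (est, A)).bind fun s => ret s.2

/-- The results of `echo`. -/
noncomputable def echoState (r : ℕ) (G : SimpleGraph V) (T : ℕ) (est : V → Fin B → ℕ∞)
    (A : V → Fin B → Fin B) : ℕ → V → Fin B → Fin B
  | 0 => A
  | t + 1 => fun v => echoRecv (echoState r G T est A t v) (heard G (fun u =>
      (due (est u) (T - t)).map fun p =>
        ((p.1, echoState r G T est A t u p.1, ⊥) : Msg B r)) v)

theorem computes_echo (T : ℕ) (est : V → Fin B → ℕ∞) (A : V → Fin B → Fin B) :
    Computes G T (fun v => (echo T (est v) (A v) : Prog (Msg B r) _))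
      (echoState r G T est A T) := by
  have h := computes_loop G (fun t (s : (Fin B → ℕ∞) × (Fin B → Fin B)) =>
    (due s.1 (T - t)).map fun p => ((p.1, s.2 p.1, ⊥) : Msg B r))
    (fun s I => (s.1, echoRecv s.2 I)) (fun v => (est v, A v)) T
  have he : ∀ t, loopState G (fun t (s : (Fin B → ℕ∞) × (Fin B → Fin B)) =>
      (due s.1 (T - t)).map fun p => ((p.1, s.2 p.1, ⊥) : Msg B r))
      (fun s I => (s.1, echoRecv s.2 I)) (fun v => (est v, A v)) t =
      fun v => (est v, echoState r G T est A t v) := by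
    intro t
    induction t with
    | zero => rfl
    | succ t ih => funext v; simp only [loopState, ih]; rfl
  rw [he] at h
  exact h.bind (Q := fun _ s => ret s.2) (computes_ret G (echoState r G T est A T))

theorem echoState_monotone {T : ℕ} {est : V → Fin B → ℕ∞} {A : V → Fin B → Fin B} (v : V)
    (l : Fin B) : Monotone fun t => echoState r G T est A t v l :=
  monotone_nat_of_le_succ fun _ => le_sup_left

theorem echoState_le {T : ℕ} {est : V → Fin B → ℕ∞} {A : V → Fin B → Fin B} (t : ℕ) (v : V)
    (l : Fin B) : echoState r G T est A t v l ≤ ⨆ x, A x l := by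
  induction t generalizing v with
  | zero => exact le_iSup (fun x => A x l) v
  | succ t ih =>
    refine sup_le (ih v) (iSup₂_le fun m hm => iSup_le fun hl => ?_)
    obtain ⟨u, hu, hs⟩ := hm
    obtain ⟨p, hp, rfl⟩ := Option.map_eq_some_iff.1 hs
    subst hl
    exact ih u

/-- The hypothesis `hx` says that `u` lies on a shortest path from `x` to the label. Along this path
due times in `detect` decrease strictly, so in the reversed schedule each node hears from its
predecessor before its own turn to send. -/
theorem le_echoState (hG : G.Connected) {T : ℕ} (hT : Enough G src T) {A : V → Fin B → Fin B}
    {l : Fin B} {u x : V} {d : ℕ} (hu : labelDist G src u l = d)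
    (hx : labelDist G src x l = (d + G.dist x u : ℕ)) :
    A x l ≤ echoState r G T (labelDist G src) A
      (T - (d + (before (labelDist G src u) l).ncard)) u l := by
  induction h : G.dist x u generalizing u d with
  | zero =>
    rw [hG.dist_eq_zero_iff.1 h]
    exact echoState_monotone u l (Nat.zero_le _)
  | succ j ih =>
    obtain ⟨u', ha, hd⟩ := exists_adj_dist hG h
    have hu' : labelDist G src u' l = (d + 1 : ℕ) := by
      refine le_antisymm ?_ ?_
      · refine (labelDist_adj hG ha.symm l).trans ?_
        rw [hu]; rfl
      -- Label distances are 1-Lipschitz: `x` is only `j` steps from `u'`, so `u'` cannot be nearer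
      -- to the label than `d + 1`.
      · have : ∀ (j : ℕ) (u' x : V), G.dist x u' = j →
            labelDist G src x l ≤ labelDist G src u' l + j := by
          intro j
          induction j with
          | zero => intro u' x h; rw [hG.dist_eq_zero_iff.1 h]; simp
          | succ j ih =>
            intro u' x h
            obtain ⟨y, hy, hyd⟩ := exists_adj_dist hG h
            refine (ih y x hyd).trans ?_
            have := labelDist_adj (src := src) hG hy.symm l
            calc _ ≤ labelDist G src u' l + 1 + j := by gcongr
              _ = _ := by push_cast; ring
        have := this j u' x hd
        rw [hx, h] at this
        rcases eq_or_ne (labelDist G src u' l) ⊤ with ht | ht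
        · rw [ht]; exact le_top
        · obtain ⟨e, he⟩ := ENat.ne_top_iff_exists.1 ht
          rw [← he] at this ⊢
          have h2 : d + (j + 1) ≤ e + j := by exact_mod_cast this
          have h3 : d + 1 ≤ e := by omega
          exact_mod_cast h3
    have h1 := ih hu' (by rw [hx, hd, h]; congr 1; omega) hd
    have h2 := hT.le u' l _ hu'
    have h3 := Set.ncard_le_ncard (before_subset_of_adj hG ha.symm hu' hu) (Set.toFinite _)
    set s' := d + 1 + (before (labelDist G src u') l).ncard with hs'
    set s := d + (before (labelDist G src u) l).ncard
    have hB : d + 1 < B := by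
      obtain ⟨y, hy, he⟩ := exists_labelDist (G := G) (src := src) (v := u') (l := l) (by simp [hu'])
      rw [hu'] at he
      have he' : d + 1 = G.dist u' y := by exact_mod_cast he
      rw [he']
      exact hT.lt u' y l hy
    have hdue : due (labelDist G src u') (T - (T - s')) = some (l, ⟨d + 1, hB⟩) :=
      due_eq_some.2 ⟨hu', by simp only []; omega⟩
    refine h1.trans (le_trans ?_ (echoState_monotone u l (show T - s' + 1 ≤ T - s by omega)))
    refine le_sup_of_le_right ?_
    refine le_iSup₂_of_le (l, echoState r G T (labelDist G src) A (T - s') u' l, ⊥) ⟨u', ha, ?_⟩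
      (le_iSup_of_le rfl le_rfl)
    exact Option.map_eq_some_iff.2 ⟨_, hdue, rfl⟩

theorem echoState_eq (hG : G.Connected) {T : ℕ} (hT : Enough G src T) {A : V → Fin B → Fin B}
    {l : Fin B} {z : V} (hz : ∀ u, l ∈ src u ↔ u = z) :
    echoState r G T (labelDist G src) A T z l = ⨆ x, A x l := by
  have hd : ∀ x, labelDist G src x l = G.dist x z := by
    intro x
    refine le_antisymm (labelDist_le ((hz z).2 rfl) x) ?_
    refine le_iInf₂ fun u hu => ?_
    rw [(hz u).1 hu]
  refine le_antisymm (echoState_le T z l) (iSup_le fun x => ?_)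
  refine (le_echoState (r := r) (u := z) (x := x) (d := 0) hG hT (by simp [hd]) (by simp [hd])).trans ?_
  exact echoState_monotone z l (Nat.sub_le _ _)

end Detect

/-! ### Skeletons approximate all distance parameters -/

section Core

variable {V : Type} {G : SimpleGraph V}

/-- A set `S` of nodes, with further nodes `w i` and numbers `h i` that witness that all distance
parameters can be approximated from the distances to `S`. -/
structure Skeleton (G : SimpleGraph V) (k : ℕ) (S : Set V) (w : ℕ → V) (h : ℕ → ℕ) : Prop where
  zero : h 0 = 0
  mem : ∀ i < k, w (i + 1) ∈ S
  near : ∀ i < k, ∀ y, G.dist (w (i + 1)) y + h i < h (i + 1) → ∃ z ∈ S, G.dist z y ≤ h i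
  cover : ∀ y, ∃ z ∈ S, G.dist z y ≤ h k

variable {k : ℕ} {S : Set V} {w : ℕ → V} {h : ℕ → ℕ}

/-- The quantity on the left at most doubles from `i` to `i + 1`, and it equals `x + 1` at `i = 0`.
The truncation at `2 * m + x + 1` covers the case in which the walk towards `v` would overshoot. -/
theorem Skeleton.min_add_le (hG : G.Connected) (hS : Skeleton G k S w h) {v : V} {m x : ℕ}
    (hR : ∀ z ∈ S, G.dist z v ≤ m + x) (hm : ∀ z ∈ S, m ≤ G.dist z v) :
    ∀ i ≤ k, min (h i) (2 * m + x + 1) + (x + 1) ≤ 2 ^ i * (x + 1) := by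
  intro i
  induction i with
  | zero => intro _; simp [hS.zero]
  | succ i ih =>
    intro hi
    have ih := ih (by omega)
    rw [pow_succ]
    have hA : 2 ^ i * 2 * (x + 1) = 2 * (2 ^ i * (x + 1)) := by ring
    suffices min (h (i + 1)) (2 * m + x + 1) + (x + 1) ≤
        2 * (min (h i) (2 * m + x + 1) + (x + 1)) by
      rw [hA]; omega
    by_cases hle : h (i + 1) ≤ h i
    · omega
    have hw := hR _ (hS.mem i hi)
    -- A walk of this length from `w (i + 1)` is the longest to which `near` applies. If it fits,
    -- its endpoint `y` gives `h (i + 1) ≤ 2 * h i + x + 1`. Otherwise `near` applies to `v` itself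
    -- and gives `m ≤ h i`, and the truncated bound suffices.
    by_cases hs : h (i + 1) - h i - 1 ≤ m + x
    · obtain ⟨y, hy, hyv⟩ := exists_near hG hw hs
      obtain ⟨z, hz, hzy⟩ := hS.near i hi y (by omega)
      have h1 := hm z hz
      have h2 := hG.dist_triangle (u := z) (v := y) (w := v)
      omega
    · obtain ⟨z, hz, hzy⟩ := hS.near i hi v (by omega)
      have h1 := hm z hz
      omega

/-- Here `z` is a skeleton node nearest to `v`. The free number `F` serves twice: as the distance to
`z` for diameter and radius, and as the error of the estimate for eccentricities. -/
theorem Skeleton.exists_add_le (hG : G.Connected) (hS : Skeleton G k S w h) {v : V} {R : ℕ}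
    (hR : ∀ z ∈ S, G.dist z v ≤ R) :
    ∃ z ∈ S, (∀ z' ∈ S, G.dist z v ≤ G.dist z' v) ∧ G.dist z v ≤ h k ∧
      ∀ F, F ≤ h k → F ≤ G.dist z v + R + 1 →
        F + (R + 1) + 2 ^ k * G.dist z v ≤ 2 ^ k * (R + 1) + G.dist z v := by
  classical
  obtain ⟨z₁, hz₁, hk⟩ := hS.cover v
  have hne : ∃ m, ∃ z ∈ S, G.dist z v = m := ⟨_, z₁, hz₁, rfl⟩
  obtain ⟨z, hz, hzm⟩ := Nat.find_spec hne
  have hm : ∀ z' ∈ S, G.dist z v ≤ G.dist z' v := fun z' hz' =>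
    hzm.trans_le (Nat.find_min' hne ⟨z', hz', rfl⟩)
  obtain ⟨x, hx⟩ := Nat.exists_eq_add_of_le (hR z hz)
  refine ⟨z, hz, hm, (hm z₁ hz₁).trans hk, fun F hF hF' => ?_⟩
  have h1 := hS.min_add_le hG (by rwa [← hx]) hm k le_rfl
  have h3 : 2 ^ k * (R + 1) = 2 ^ k * G.dist z v + 2 ^ k * (x + 1) := by rw [hx]; ring
  omega

/-- The eccentricity of a node as a natural number. -/
noncomputable def ecc (G : SimpleGraph V) (v : V) : ℕ := (G.eccent v).toNat

theorem coe_ecc [Finite V] (hG : G.Connected) (v : V) : (ecc G v : ℕ∞) = G.eccent v := by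
  have := hG.nonempty
  refine ENat.natCast_toNat ?_
  exact ne_top_of_le_ne_top (SimpleGraph.connected_iff_ediam_ne_top.1 hG)
    SimpleGraph.eccent_le_ediam

theorem dist_le_ecc [Finite V] (hG : G.Connected) (v u : V) : G.dist v u ≤ ecc G v := by
  have h : G.edist v u ≤ G.eccent v := SimpleGraph.edist_le_eccent
  rw [← coe_ecc hG, ← (hG v u).coe_dist_eq_edist] at h
  exact_mod_cast h

theorem exists_dist_eq_ecc [Finite V] (hG : G.Connected) (v : V) : ∃ u, G.dist v u = ecc G v := by
  have := hG.nonempty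
  obtain ⟨u, hu⟩ := SimpleGraph.exists_edist_eq_eccent_of_finite (G := G) v
  refine ⟨u, ?_⟩
  rw [← coe_ecc hG, ← (hG v u).coe_dist_eq_edist] at hu
  exact_mod_cast hu

theorem ecc_le_diam [Finite V] (hG : G.Connected) (v : V) : ecc G v ≤ G.diam := by
  obtain ⟨u, hu⟩ := exists_dist_eq_ecc hG v
  exact hu ▸ dist_le_diam hG v u

theorem radius_le_ecc [Finite V] (hG : G.Connected) (v : V) : G.radius.toNat ≤ ecc G v := by
  have h : G.radius ≤ G.eccent v := SimpleGraph.radius_le_eccent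
  rw [← coe_ecc hG] at h
  exact ENat.toNat_le_of_le_natCast h

theorem exists_ecc_eq_radius [Finite V] (hG : G.Connected) : ∃ v, ecc G v = G.radius.toNat := by
  have := hG.nonempty
  obtain ⟨v, hv⟩ := SimpleGraph.exists_eccent_eq_radius (G := G)
  exact ⟨v, by rw [ecc, hv]⟩

theorem Skeleton.exists_near (hG : G.Connected) (hS : Skeleton G k S w h) {v : V} {R : ℕ}
    (hR : ∀ z ∈ S, G.dist z v ≤ R) :
    ∃ z ∈ S, (2 : ℝ) ^ k * G.dist z v ≤ (2 ^ k - 1) * (R + 1) := by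
  obtain ⟨z, hz, -, hk, hF⟩ := hS.exists_add_le hG hR
  refine ⟨z, hz, ?_⟩
  have h1 : ((G.dist z v + (R + 1) + 2 ^ k * G.dist z v : ℕ) : ℝ) ≤
      (2 ^ k * (R + 1) + G.dist z v : ℕ) := by exact_mod_cast hF _ hk (by omega)
  push_cast at h1
  linarith

variable [Finite V]

/-- All distances from the skeleton are at most `d`. An end `a` of a diametral path therefore has a
skeleton node within about `(1 - 1 / 2 ^ k) * d`, and the other end is within `d` of that node. -/
theorem Skeleton.approximates_diam (hG : G.Connected) (hS : Skeleton G k S w h) {d : ℕ}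
    (h1 : ∀ z ∈ S, ecc G z ≤ d) (h2 : ∃ z, ecc G z = d) :
    Approximates (2 - 1 / 2 ^ k) 3 d G.diam := by
  have := hG.nonempty
  obtain ⟨z, hz⟩ := h2
  refine ⟨hz ▸ ecc_le_diam hG z, ?_⟩
  obtain ⟨a, b, hab⟩ := SimpleGraph.exists_dist_eq_diam (G := G)
  have hd : ∀ z ∈ S, ∀ y, G.dist z y ≤ d := fun z hz y => (dist_le_ecc hG z y).trans (h1 z hz)
  obtain ⟨z, hz, hle⟩ := hS.exists_near hG fun z hz => hd z hz a
  have ht := hG.dist_triangle (u := a) (v := z) (w := b)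
  have h4 := hd z hz b
  rw [G.dist_comm (u := a) (v := z), hab] at ht
  have h5 : (G.diam : ℝ) ≤ G.dist z a + d := by exact_mod_cast ht.trans (by omega)
  have hp : (1 : ℝ) ≤ 2 ^ k := one_le_pow₀ (by norm_num)
  have h6 : (G.dist z a : ℝ) ≤ (2 ^ k - 1) * (d + 1) / 2 ^ k := by
    rw [le_div_iff₀ (by positivity)]; linarith
  have h7 : (2 ^ k - 1) * ((d : ℝ) + 1) / 2 ^ k = (1 - 1 / 2 ^ k) * (d + 1) := by
    field_simp
  have h8 : (0 : ℝ) ≤ 1 / 2 ^ k := by positivity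
  rw [h7] at h6
  linarith

/-- The smallest skeleton eccentricity `x` overestimates the radius. A skeleton node near a centre
shows that `x` is at most `2 - 1 / 2 ^ k` times the radius, plus one. Subtracting one and dividing
by the factor turns `x` into a lower estimate. -/
theorem Skeleton.approximates_radius (hG : G.Connected) (hS : Skeleton G k S w h) {x : ℕ}
    (h1 : ∀ z ∈ S, x ≤ ecc G z) (h2 : ∃ z, ecc G z = x) :
    Approximates (2 - 1 / 2 ^ k) 3 ((x - 1) * 2 ^ k / (2 * 2 ^ k - 1)) G.radius.toNat := by
  obtain ⟨y, hy⟩ := h2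
  obtain ⟨c, hc⟩ := exists_ecc_eq_radius hG
  have hR := radius_le_ecc hG y
  set R := G.radius.toNat
  obtain ⟨z, hz, hle⟩ := hS.exists_near hG (v := c) (R := R) fun z _ => by
    rw [SimpleGraph.dist_comm, ← hc]; exact dist_le_ecc hG c z
  obtain ⟨u, hu⟩ := exists_dist_eq_ecc hG z
  have ht := hG.dist_triangle (u := z) (v := c) (w := u)
  have h3 := dist_le_ecc hG c u
  rw [hc] at h3
  have h4 : (x : ℝ) ≤ G.dist z c + R := by
    have := h1 z hz
    exact_mod_cast (by omega : x ≤ G.dist z c + R)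
  have hp1 : 1 ≤ 2 ^ k := Nat.one_le_two_pow
  have hp : (1 : ℝ) ≤ 2 ^ k := one_le_pow₀ (by norm_num)
  have hq : ((2 * 2 ^ k - 1 : ℕ) : ℝ) = 2 * 2 ^ k - 1 := by
    rw [Nat.cast_sub (by omega)]; push_cast; ring
  have h5 : (x : ℝ) * 2 ^ k ≤ (2 * 2 ^ k - 1) * R + 2 ^ k := by
    have := mul_le_mul_of_nonneg_right h4 (by positivity : (0 : ℝ) ≤ 2 ^ k)
    linarith
  constructor
  · have h6 : (x - 1) * 2 ^ k ≤ (2 * 2 ^ k - 1) * R := by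
      rcases Nat.eq_zero_or_pos x with h0 | h0
      · simp [h0]
      · have : (((x - 1) * 2 ^ k : ℕ) : ℝ) ≤ ((2 * 2 ^ k - 1) * R : ℕ) := by
          rw [Nat.cast_mul (2 * 2 ^ k - 1), hq]
          push_cast [Nat.cast_sub h0]
          linarith
        exact_mod_cast this
    exact Nat.div_le_of_le_mul h6
  · set e := (x - 1) * 2 ^ k / (2 * 2 ^ k - 1) with he
    have h6 : (x - 1) * 2 ^ k < (2 * 2 ^ k - 1) * (e + 1) := by
      have := Nat.lt_mul_div_succ ((x - 1) * 2 ^ k) (show 0 < 2 * 2 ^ k - 1 by omega)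
      simpa [he] using this
    have h7 : (((x - 1) * 2 ^ k : ℕ) : ℝ) ≤ ((2 * 2 ^ k - 1) * (e + 1) : ℕ) := by
      exact_mod_cast h6.le
    rw [Nat.cast_mul (2 * 2 ^ k - 1), hq] at h7
    push_cast at h7
    have h8 : (x : ℝ) - 1 ≤ ((x - 1 : ℕ) : ℝ) := by
      have : x ≤ (x - 1) + 1 := by omega
      have : (x : ℝ) ≤ ((x - 1 : ℕ) : ℝ) + 1 := by exact_mod_cast this
      linarith
    have h9 : ((x - 1 : ℕ) : ℝ) ≤ (2 - 1 / 2 ^ k) * (e + 1) := by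
      have : ((x - 1 : ℕ) : ℝ) ≤ (2 * 2 ^ k - 1) * (e + 1) / 2 ^ k := by
        rw [le_div_iff₀ (by positivity)]; exact h7
      calc _ ≤ _ := this
        _ = _ := by field_simp
    have h10 : (R : ℝ) ≤ x := by exact_mod_cast (hy ▸ hR)
    have h11 : (0 : ℝ) ≤ 1 / 2 ^ k := by positivity
    linarith

/-- The error `ecc G v - t` is at most `h k`, through a skeleton node near the farthest node from
`v`, and at most twice the distance `m` from `v` to its nearest skeleton node. The first bound gives
an inequality that improves as `m` grows; substituting the second eliminates `m`. -/
theorem Skeleton.approximates_ecc (hG : G.Connected) (hS : Skeleton G k S w h) {v : V} {t : ℕ}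
    (h1 : ∀ z ∈ S, G.dist z v ≤ t) (h2 : ∀ z ∈ S, ecc G z ≤ t + G.dist z v)
    (h3 : t ≤ ecc G v) :
    Approximates (3 - 4 / (2 ^ k + 1)) 3 t (G.eccent v).toNat := by
  refine ⟨h3, ?_⟩
  change (ecc G v : ℝ) ≤ _
  obtain ⟨z, hz, -, -, hF⟩ := hS.exists_add_le hG h1
  obtain ⟨a, ha⟩ := exists_dist_eq_ecc hG v
  obtain ⟨z', hz', hk⟩ := hS.cover a
  have e1 := hG.dist_triangle (u := v) (v := z') (w := a)
  have e2 := h1 z' hz'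
  have e3 := hG.dist_triangle (u := v) (v := z) (w := a)
  have e4 := h2 z hz
  have e5 := dist_le_ecc hG z a
  rw [G.dist_comm (u := v) (v := z')] at e1
  rw [G.dist_comm (u := v) (v := z)] at e3
  have e6 := h1 z hz
  have e7 := hF (ecc G v - t) (by omega) (by omega)
  have e8 : ((ecc G v : ℝ) - t) + (t + 1) + 2 ^ k * G.dist z v ≤ 2 ^ k * (t + 1) + G.dist z v := by
    have : ecc G v - t + t = ecc G v := by omega
    have h : ecc G v + 1 + 2 ^ k * G.dist z v ≤ 2 ^ k * (t + 1) + G.dist z v := by omega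
    have h' : ((ecc G v + 1 + 2 ^ k * G.dist z v : ℕ) : ℝ) ≤
      (2 ^ k * (t + 1) + G.dist z v : ℕ) := by exact_mod_cast h
    push_cast at h'
    linarith
  have e9 : (ecc G v : ℝ) - t ≤ 2 * G.dist z v := by
    have : (ecc G v : ℝ) ≤ t + 2 * G.dist z v := by
      exact_mod_cast (by omega : ecc G v ≤ t + 2 * G.dist z v)
    linarith
  have hp : (1 : ℝ) ≤ 2 ^ k := one_le_pow₀ (by norm_num)
  have e10 := mul_le_mul_of_nonneg_left e9 (by linarith : (0 : ℝ) ≤ 2 ^ k - 1)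
  have e11 : (ecc G v : ℝ) * (2 ^ k + 1) ≤ (3 * 2 ^ k - 1) * t + 2 * 2 ^ k := by linarith
  have e12 : (ecc G v : ℝ) ≤ ((3 * 2 ^ k - 1) * t + 2 * 2 ^ k) / (2 ^ k + 1) := by
    rw [le_div_iff₀ (by positivity)]; exact e11
  have e13 : ((3 * 2 ^ k - 1) * t + 2 * 2 ^ k) / (2 ^ k + 1) =
      (3 - 4 / (2 ^ k + 1)) * (t : ℝ) + 2 - 2 / (2 ^ k + 1) := by
    field_simp
    ring
  have e14 : (0 : ℝ) ≤ 2 / (2 ^ k + 1) := by positivity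
  linarith

end Core

/-! ### Concentration of the samples, by counting -/

section Sampling

open Finset

variable {V X : Type} [Fintype V] [Fintype X] [DecidableEq V]

theorem sum_prod_ite (T : Finset V) (f : X → ℝ) :
    ∑ ω : V → X, ∏ v, (if v ∈ T then f (ω v) else 1) =
      (∑ x, f x) ^ #T * (Fintype.card X : ℝ) ^ (Fintype.card V - #T) := by
  have h := Finset.prod_univ_sum (fun _ : V => (univ : Finset X))
    (fun v x => if v ∈ T then f x else 1)
  rw [Fintype.piFinset_univ] at h
  rw [← h]
  have h2 : ∀ v : V, (∑ x : X, if v ∈ T then f x else 1) =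
      if v ∈ T then ∑ x, f x else (Fintype.card X : ℝ) := by
    intro v
    split_ifs <;> simp
  simp only [h2]
  rw [Finset.prod_ite, Finset.prod_const, Finset.prod_const]
  congr 2
  · congr 1; ext v; simp
  · rw [← Finset.card_compl]; congr 1; ext v; simp

theorem sum_prod_ite_le {T : Finset V} {f : X → ℝ} {c : ℝ} (hf : ∀ x, 0 ≤ f x)
    (hc : ∑ x, f x ≤ Fintype.card X * Real.exp c) :
    ∑ ω : V → X, ∏ v, (if v ∈ T then f (ω v) else 1) ≤
      Fintype.card (V → X) * Real.exp (#T * c) := by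
  rw [sum_prod_ite]
  have h1 : (∑ x, f x) ^ #T ≤ (Fintype.card X * Real.exp c) ^ #T :=
    pow_le_pow_left₀ (sum_nonneg fun x _ => hf x) hc _
  calc _ ≤ (Fintype.card X * Real.exp c) ^ #T * (Fintype.card X : ℝ) ^ (Fintype.card V - #T) := by
        gcongr
    _ = (Fintype.card X : ℝ) ^ (#T + (Fintype.card V - #T)) * Real.exp (#T * c) := by
        rw [mul_pow, ← Real.exp_nat_mul, pow_add]; ring
    _ = _ := by
        rw [Nat.add_sub_cancel' (card_le_univ T), Fintype.card_fun, Nat.cast_pow]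

variable {z : X → Prop} [DecidablePred z] {Q : ℕ}

/-- Each node is sampled with probability `1 / Q`, so all of `T` is missed with probability `(1 - 1
/ Q) ^ #T ≤ exp (-L) ≤ 2 ^ (-L)`. -/
theorem card_forall_not_mul_le (hQ : #{x | z x} * Q = Fintype.card X) (T : Finset V) {L : ℕ}
    (hT : Q * L ≤ #T) (hX : 0 < Fintype.card X) :
    (#{ω : V → X | ∀ v ∈ T, ¬ z (ω v)} : ℝ) * 2 ^ L ≤ Fintype.card (V → X) := by
  have hQ0 : 0 < Q := Nat.pos_of_ne_zero fun h => by simp [h] at hQ; omega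
  have hQ' : (0 : ℝ) < Q := by exact_mod_cast hQ0
  have hz : (#{x | z x} : ℝ) = Fintype.card X / Q := by
    rw [eq_div_iff hQ'.ne']; exact_mod_cast hQ
  have hsum : ∑ x, (if z x then (0 : ℝ) else 1) ≤ Fintype.card X * Real.exp (-(1 / Q)) := by
    have h1 : ∑ x, (if z x then (0 : ℝ) else 1) = Fintype.card X - #{x | z x} := by
      have : ∀ x, (if z x then (0 : ℝ) else 1) = 1 - if z x then 1 else 0 := by
        intro x; split_ifs <;> simp
      simp only [this, sum_sub_distrib, sum_boole]
      simp
    rw [h1, hz]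
    have h2 := Real.add_one_le_exp (-(1 / (Q : ℝ)))
    calc _ = (Fintype.card X : ℝ) * (-(1 / Q) + 1) := by ring
      _ ≤ _ := by gcongr
  have h := sum_prod_ite_le (T := T) (fun x => by split_ifs <;> simp) hsum
  have hle : (#{ω : V → X | ∀ v ∈ T, ¬ z (ω v)} : ℝ) ≤
      ∑ ω : V → X, ∏ v, (if v ∈ T then (if z (ω v) then (0 : ℝ) else 1) else 1) := by
    rw [← sum_boole]
    refine sum_le_sum fun ω _ => ?_
    split_ifs with hω
    · refine le_of_eq (Eq.symm (prod_eq_one fun v _ => ?_))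
      split_ifs with h1 h2
      · exact absurd h2 (hω v h1)
      · rfl
      · rfl
    · refine prod_nonneg fun v _ => ?_
      split_ifs <;> simp
  have hexp : Real.exp (#T * (-(1 / Q))) * 2 ^ L ≤ 1 := by
    have h1 : (2 : ℝ) ^ L ≤ Real.exp L := by
      have := Real.add_one_le_exp (1 : ℝ)
      calc (2 : ℝ) ^ L ≤ Real.exp 1 ^ L := by gcongr; linarith
        _ = _ := by rw [← Real.exp_nat_mul, mul_one]
    have h2 : (Q * L : ℝ) ≤ #T := by exact_mod_cast hT
    calc _ ≤ Real.exp (#T * (-(1 / Q))) * Real.exp L := by gcongr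
      _ = Real.exp (L - #T / Q) := by rw [← Real.exp_add]; congr 1; ring
      _ ≤ 1 := by
        rw [Real.exp_le_one_iff, sub_nonpos, le_div_iff₀ hQ']
        linarith
  calc _ ≤ (Fintype.card (V → X) * Real.exp (#T * (-(1 / Q)))) * 2 ^ L := by
        gcongr; exact hle.trans h
    _ = Fintype.card (V → X) * (Real.exp (#T * (-(1 / Q))) * 2 ^ L) := by ring
    _ ≤ Fintype.card (V → X) * 1 := by gcongr
    _ = _ := mul_one _

/-- Markov's inequality for 2 to the number of sampled nodes: the expectation is at most `exp W ≤ 4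
^ W`, while the bad event forces at least `8 ^ W`. -/
theorem card_lt_card_mul_le (hQ : #{x | z x} * Q = Fintype.card X) (T : Finset V) {W : ℕ}
    (hT : #T ≤ Q * W) (hX : 0 < Fintype.card X) :
    (#{ω : V → X | 3 * W < #{v ∈ T | z (ω v)}} : ℝ) * 2 ^ W ≤ Fintype.card (V → X) := by
  have hQ0 : 0 < Q := Nat.pos_of_ne_zero fun h => by simp [h] at hQ; omega
  have hQ' : (0 : ℝ) < Q := by exact_mod_cast hQ0
  have hz : (#{x | z x} : ℝ) = Fintype.card X / Q := by
    rw [eq_div_iff hQ'.ne']; exact_mod_cast hQ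
  have hsum : ∑ x, (if z x then (2 : ℝ) else 1) ≤ Fintype.card X * Real.exp (1 / Q) := by
    have h1 : ∑ x, (if z x then (2 : ℝ) else 1) = Fintype.card X + #{x | z x} := by
      have : ∀ x, (if z x then (2 : ℝ) else 1) = 1 + if z x then 1 else 0 := by
        intro x; split_ifs <;> norm_num
      simp only [this, sum_add_distrib, sum_boole]
      simp
    rw [h1, hz]
    have h2 := Real.add_one_le_exp (1 / (Q : ℝ))
    calc _ = (Fintype.card X : ℝ) * (1 / Q + 1) := by ring
      _ ≤ _ := by gcongr
  have h := sum_prod_ite_le (T := T) (fun x => by split_ifs <;> simp) hsum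
  have hle : (#{ω : V → X | 3 * W < #{v ∈ T | z (ω v)}} : ℝ) * 2 ^ (3 * W) ≤
      ∑ ω : V → X, ∏ v, (if v ∈ T then (if z (ω v) then (2 : ℝ) else 1) else 1) := by
    rw [← sum_boole, sum_mul]
    refine sum_le_sum fun ω _ => ?_
    have hprod : ∏ v, (if v ∈ T then (if z (ω v) then (2 : ℝ) else 1) else 1) =
        2 ^ #{v ∈ T | z (ω v)} := by
      rw [← prod_const, prod_ite_mem, univ_inter, prod_filter]
    rw [hprod]
    split_ifs with hω
    · rw [one_mul]
      exact pow_le_pow_right₀ (by norm_num) hω.le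
    · rw [zero_mul]; positivity
  have hexp : Real.exp (#T * (1 / Q)) ≤ 4 ^ W := by
    have h2 : (#T : ℝ) ≤ Q * W := by exact_mod_cast hT
    have h3 : Real.exp 1 ≤ 4 := by have := Real.exp_one_lt_d9; linarith
    calc Real.exp (#T * (1 / Q)) ≤ Real.exp (W * 1) := by
          refine Real.exp_le_exp.2 ?_
          rw [mul_one_div, mul_one, div_le_iff₀ hQ']; linarith
      _ = Real.exp 1 ^ W := Real.exp_nat_mul 1 W
      _ ≤ _ := by gcongr
  have h5 : (#{ω : V → X | 3 * W < #{v ∈ T | z (ω v)}} : ℝ) * 2 ^ W * 4 ^ W ≤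
      Fintype.card (V → X) * 4 ^ W := by
    calc _ = (#{ω : V → X | 3 * W < #{v ∈ T | z (ω v)}} : ℝ) * 2 ^ (3 * W) := by
          rw [mul_assoc, ← mul_pow, pow_mul]; norm_num
      _ ≤ _ := hle.trans h
      _ ≤ _ := by gcongr
  exact le_of_mul_le_mul_right h5 (by positivity)

theorem card_prefix_mul {m l : ℕ} (h : l ≤ m) :
    #{x : Fin m → Bool | ∀ j : Fin m, (j : ℕ) < l → x j = true} * 2 ^ l = 2 ^ m := by
  obtain ⟨r, rfl⟩ := Nat.exists_eq_add_of_le h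
  have h1 : ({x : Fin (l + r) → Bool | ∀ j : Fin (l + r), (j : ℕ) < l → x j = true} : Finset _) =
      Fintype.piFinset fun j : Fin (l + r) => if (j : ℕ) < l then {true} else univ := by
    ext x
    simp only [mem_filter, mem_univ, true_and, Fintype.mem_piFinset]
    refine forall_congr' fun j => ?_
    split_ifs with hj <;> simp [hj]
  rw [h1, Fintype.card_piFinset]
  have h2 : ∀ j : Fin (l + r), #(if (j : ℕ) < l then ({true} : Finset Bool) else univ) =
      if (j : ℕ) < l then 1 else 2 := by
    intro j; split_ifs <;> simp
  simp only [h2]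
  rw [Fin.prod_univ_eq_prod_range (fun j => if j < l then 1 else 2), prod_range_add]
  have h3 : ∏ j ∈ range l, (if j < l then 1 else 2) = 1 :=
    prod_eq_one fun j hj => if_pos (mem_range.1 hj)
  simp [h3, pow_add, mul_comm]

/-- The random bits of a node put it into the `i`-th sample. -/
def InSample (g i : ℕ) {m : ℕ} (x : Fin m → Bool) : Prop :=
  ∀ j : Fin m, (j : ℕ) < i * g → x j = true

/-- The samples hit the large sets `T τ` and have few elements in the small ones. -/
def GoodSample {ι : Type} (k g L m : ℕ) (T : ι → Finset V) (ω : V → Fin m → Bool) : Prop :=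
  ∀ τ, ∀ i ≤ k, ((2 ^ g) ^ i * L ≤ #(T τ) → ∃ v ∈ T τ, InSample g i (ω v)) ∧
    (#(T τ) ≤ (2 ^ g) ^ (i + 1) * L →
      {v | v ∈ T τ ∧ InSample g i (ω v)}.ncard ≤ 3 * (2 ^ g * L))

-- Union bound over sets, levels and the two kinds of failure, each of probability at most `2 ^
-- (-L)`.
open Classical in
theorem card_not_goodSample {ι : Type} [Fintype ι] (k g L : ℕ) (T : ι → Finset V) :
    (#{ω : V → Fin (k * g) → Bool | ¬ GoodSample k g L (k * g) T ω} : ℝ) * 2 ^ L ≤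
      Fintype.card ι * (k + 1) * 2 * Fintype.card (V → Fin (k * g) → Bool) := by
  set N : ℝ := ((Fintype.card (V → Fin (k * g) → Bool) : ℕ) : ℝ)
  let E₁ : ι × Fin (k + 1) → Finset (V → Fin (k * g) → Bool) := fun p =>
    if (2 ^ g) ^ (p.2 : ℕ) * L ≤ #(T p.1) 
    then ({ω | ∀ v ∈ T p.1, ¬ InSample g p.2 (ω v)} : Finset (V → Fin (k * g) → Bool)) else ∅
  let E₂ : ι × Fin (k + 1) → Finset (V → Fin (k * g) → Bool) := fun p =>
    if #(T p.1) ≤ (2 ^ g) ^ ((p.2 : ℕ) + 1) * L then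
      ({ω | 3 * (2 ^ g * L) < #{v ∈ T p.1 | InSample g p.2 (ω v)}} :
        Finset (V → Fin (k * g) → Bool)) else ∅
  have hX : 0 < Fintype.card (Fin (k * g) → Bool) := Fintype.card_pos
  have hc : ∀ i : Fin (k + 1), #{x : Fin (k * g) → Bool | InSample g i x} * (2 ^ g) ^ (i : ℕ) =
      Fintype.card (Fin (k * g) → Bool) := by
    intro i
    have h := card_prefix_mul (m := k * g) (l := i * g)
      (Nat.mul_le_mul_right g (Nat.le_of_lt_succ i.2))
    rw [← pow_mul, mul_comm g, Fintype.card_fun, Fintype.card_bool, Fintype.card_fin, ← h]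
    congr 1
    exact congrArg card (filter_congr fun _ _ => Iff.rfl)
  have h1 : ∀ p, (#(E₁ p) : ℝ) * 2 ^ L ≤ N := by
    intro p
    by_cases h : (2 ^ g) ^ (p.2 : ℕ) * L ≤ #(T p.1)
    · simp only [E₁, if_pos h]
      exact card_forall_not_mul_le (hc p.2) _ h hX
    · simp only [E₁, if_neg h, card_empty, Nat.cast_zero, zero_mul]
      positivity
  have h2 : ∀ p, (#(E₂ p) : ℝ) * 2 ^ L ≤ N := by
    intro p
    by_cases h : #(T p.1) ≤ (2 ^ g) ^ ((p.2 : ℕ) + 1) * L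
    · simp only [E₂, if_pos h]
      -- The expected number of sampled nodes is at most `W = 2 ^ g * L`; as `W ≥ L`, the tail `2 ^
      -- (-W)` is small enough.
      refine le_trans ?_ (card_lt_card_mul_le (hc p.2) (T p.1) (W := 2 ^ g * L)
        (h.trans (by rw [pow_succ, mul_assoc])) hX)
      gcongr
      · norm_num
      · exact Nat.le_mul_of_pos_left L (by positivity)
    · simp only [E₂, if_neg h, card_empty, Nat.cast_zero, zero_mul]
      positivity
  have hsub : ({ω | ¬ GoodSample k g L (k * g) T ω} : Finset (V → Fin (k * g) → Bool)) ⊆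
      univ.biUnion fun p => E₁ p ∪ E₂ p := by
    intro ω hω
    simp only [mem_filter, mem_univ, true_and] at hω
    simp only [mem_biUnion, mem_univ, true_and, mem_union]
    by_contra hcon
    push Not at hcon
    refine hω fun τ i hi => ⟨fun h => ?_, fun h => ?_⟩
    · have := (hcon (τ, ⟨i, Nat.lt_succ_of_le hi⟩)).1
      simp only [E₁, if_pos h, mem_filter, mem_univ, true_and] at this
      push Not at this
      exact this
    · have := (hcon (τ, ⟨i, Nat.lt_succ_of_le hi⟩)).2
      simp only [E₂, if_pos h, mem_filter, mem_univ, true_and, not_lt] at this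
      refine le_trans (le_of_eq ?_) this
      rw [← Set.ncard_coe_finset]
      congr 1
      ext v
      simp
  have h3 : (#({ω | ¬ GoodSample k g L (k * g) T ω} : Finset (V → Fin (k * g) → Bool)) : ℝ) ≤
      ∑ p, ((#(E₁ p) : ℝ) + #(E₂ p)) := by
    have := (card_le_card hsub).trans (card_biUnion_le.trans
      (sum_le_sum fun p _ => card_union_le (E₁ p) (E₂ p)))
    exact_mod_cast this
  calc _ ≤ (∑ p, ((#(E₁ p) : ℝ) + #(E₂ p))) * 2 ^ L := by gcongr
    _ = ∑ p, ((#(E₁ p) : ℝ) * 2 ^ L + #(E₂ p) * 2 ^ L) := by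
      rw [sum_mul]; exact sum_congr rfl fun p _ => add_mul _ _ _
    _ ≤ ∑ _p : ι × Fin (k + 1), (N + N) := sum_le_sum fun p _ => add_le_add (h1 p) (h2 p)
    _ = _ := by
      simp only [sum_const, card_univ, Fintype.card_prod, Fintype.card_fin, nsmul_eq_mul]
      push_cast
      ring

end Sampling

/-! ### A unanimous test for guesses of the diameter -/

section Consensus

variable {V : Type} {G : SimpleGraph V} {B : ℕ} [NeZero B]

theorem exists_iSup₂_eq [Finite V] {p : V → Prop} (h : ∃ x, p x) (f : V → Fin B) :
    ∃ x, p x ∧ ⨆ x, ⨆ _ : p x, f x = f x := by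
  have : Nonempty {x // p x} := let ⟨x, hx⟩ := h; ⟨⟨x, hx⟩⟩
  obtain ⟨x, hx⟩ := exists_eq_ciSup_of_finite (f := fun x : {x // p x} => f x)
  exact ⟨x, x.2, by rw [hx, iSup_subtype]⟩

/-- The maximum of the values `f` at distance at most `T`. -/
noncomputable def ballMax (G : SimpleGraph V) (T : ℕ) (f : V → Fin B) (v : V) : Fin B :=
  ⨆ u, ⨆ _ : G.dist v u ≤ T, f u

theorem le_ballMax {T : ℕ} {f : V → Fin B} {u v : V} (h : G.dist v u ≤ T) :
    f u ≤ ballMax G T f v := le_iSup₂_of_le u h le_rfl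

/-- Flooding only computes maxima. Reversal turns a minimum into a maximum, and a function is
constant on a ball when its minimum equals its maximum. -/
theorem ballMax_eq_rev_iff {T : ℕ} {f : V → Fin B} {v : V} :
    ballMax G T (fun u => (f u).rev) v = (ballMax G T f v).rev ↔
      ∀ u, G.dist v u ≤ T → f u = f v := by
  have hv : G.dist v v ≤ T := by rw [SimpleGraph.dist_self]; exact Nat.zero_le _
  constructor
  · intro h
    have key : ∀ u, G.dist v u ≤ T → f u = ballMax G T f v := by
      intro u hu
      refine le_antisymm (le_ballMax hu) ?_
      have := le_ballMax (f := fun u => (f u).rev) hu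
      rw [h] at this
      exact Fin.rev_le_rev.1 this
    intro u hu
    rw [key u hu, key v hv]
  · intro h
    have h1 : ballMax G T f v = f v :=
      le_antisymm (iSup₂_le fun u hu => (h u hu).le) (le_ballMax hv)
    have h2 : ballMax G T (fun u => (f u).rev) v = (f v).rev :=
      le_antisymm (iSup₂_le fun u hu => (congrArg Fin.rev (h u hu)).le) (le_ballMax (f := fun u => (f u).rev) hv)
    rw [h1, h2]

/-- All nodes at distance at most `2 * Δ + 1` from `v` see the same maximum within distance `Δ`. -/
def Passes (G : SimpleGraph V) (Δ : ℕ) (f : V → Fin B) (v : V) : Prop :=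
  ∀ u, G.dist v u ≤ 2 * Δ + 1 → ballMax G Δ f u = ballMax G Δ f v

variable [Finite V]

theorem passes_of_diam_le (hG : G.Connected) {Δ : ℕ} (h : G.diam ≤ Δ) (f : V → Fin B) (v : V) :
    Passes G Δ f v := by
  intro u _
  have : ∀ x y, G.dist x y ≤ Δ := fun x y => (dist_le_diam hG x y).trans h
  simp [ballMax, this]

/-- Let `x` carry the maximum seen by `v`. If some node were farther than `Δ` from `x`, there would
be a node `y` at distance exactly `Δ + 1`. It is within `2 * Δ + 1` of `v`, so it sees the same
maximum, which by injectivity comes from `x`; but `x` is out of its sight. -/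
theorem Passes.dist_le (hG : G.Connected) {Δ : ℕ} {f : V → Fin B} (hf : Function.Injective f)
    {v : V} (h : Passes G Δ f v) : ∃ x, ∀ u, G.dist x u ≤ Δ := by
  obtain ⟨x, hx, he⟩ := exists_iSup₂_eq (p := fun u => G.dist v u ≤ Δ)
    ⟨v, by rw [SimpleGraph.dist_self]; exact Nat.zero_le _⟩ f
  refine ⟨x, fun u => ?_⟩
  by_contra hu
  obtain ⟨y, hy, -⟩ := exists_between hG (w := x) (v := u) (a := Δ + 1) (b := G.dist x u - (Δ + 1))
    (by omega)
  have ht := hG.dist_triangle (u := v) (v := x) (w := y)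
  have h1 := h y (by omega)
  obtain ⟨x', hx', he'⟩ := exists_iSup₂_eq (p := fun u => G.dist y u ≤ Δ)
    ⟨y, by rw [SimpleGraph.dist_self]; exact Nat.zero_le _⟩ f
  have h2 : f x' = f x := he'.symm.trans (h1.trans he)
  rw [hf h2, SimpleGraph.dist_comm] at hx'
  omega

theorem Passes.diam_le (hG : G.Connected) {Δ : ℕ} {f : V → Fin B} (hf : Function.Injective f)
    {v : V} (h : Passes G Δ f v) : G.diam ≤ 2 * Δ := by
  have := hG.nonempty
  obtain ⟨x, hx⟩ := h.dist_le hG hf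
  obtain ⟨a, b, hab⟩ := SimpleGraph.exists_dist_eq_diam (G := G)
  have ht := hG.dist_triangle (u := a) (v := x) (w := b)
  have h1 := hx a
  have h2 := hx b
  rw [SimpleGraph.dist_comm] at h1
  omega

/-- Once one node passes, the diameter is at most `2 * Δ`, so its comparison has covered the whole
graph. Hence all nodes accept the same guess. -/
theorem Passes.all (hG : G.Connected) {Δ : ℕ} {f : V → Fin B} (hf : Function.Injective f)
    {v : V} (h : Passes G Δ f v) (u : V) : Passes G Δ f u := by
  have hd := h.diam_le hG hf
  intro w _
  rw [h w ((dist_le_diam hG v w).trans (by omega)), h u ((dist_le_diam hG v u).trans (by omega))]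

end Consensus

/-! ### The computation for one guess -/

section Attempt

variable (B k n P : ℕ) [NeZero B]

/-- The estimates, computed from the distances to the labels `ecc z * P + ident z` of the nodes `z`
of a skeleton. -/
noncomputable def finalEstimate {B : ℕ} (k P : ℕ) (est : Fin B → ℕ∞) : Estimate where
  diam := sSup ((fun l : Fin B => (l : ℕ) / P) '' {l : Fin B | est l ≠ ⊤})
  radius := (sInf ((fun l : Fin B => (l : ℕ) / P) '' {l : Fin B | est l ≠ ⊤}) - 1) * 2 ^ k / (2 * 2 ^ k - 1)
  ecc := sSup ((fun l : Fin B => max (est l).toNat ((l : ℕ) / P - (est l).toNat)) '' {l : Fin B | est l ≠ ⊤})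

/-- The node with identifier `id` and samples `smp` belongs to the skeleton. -/
def Selected {B k : ℕ} [NeZero B] (P id : ℕ) (smp : ℕ → Prop) (x : Fin (k + 1) → Fin B)
    (est : Fin B → ℕ∞) : Prop :=
  smp k ∨ ∃ i : Fin k, id = x i.succ % P ∨
    (smp i ∧ est (Fin.ofNat B (x i.succ % P)) < ((x i.succ / P : ℕ) : ℕ∞))

/-- The labels of the samples of a node. -/
def sampleLabels (smp : ℕ → Prop) : Set (Fin B) := {l | ∃ i ≤ k, smp i ∧ l = Fin.ofNat B i}

/-- A node's distance to the samples, together with its identifier. -/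
noncomputable def farCode (id : ℕ) (est : Fin B → ℕ∞) (i : Fin (k + 1)) : Fin B :=
  Fin.ofNat B ((min (est (Fin.ofNat B i)) n).toNat * P + id)

/-- The label of a node that is farthest from a sample. -/
def farLabels {k : ℕ} (id : ℕ) (x : Fin (k + 1) → Fin B) : Set (Fin B) :=
  {l | l = Fin.ofNat B id ∧ ∃ i : Fin k, id = x i.succ % P}

/-- The computation for the guess `Δ` of the diameter. It returns `none` if the guess is too
small. -/
noncomputable def attempt (Δ ℓ id : ℕ) (smp : ℕ → Prop) :
    Prog (Msg B (k + 1)) (Option Estimate) :=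
  (flood Δ fun _ => Fin.ofNat B id).bind fun m =>
  (flood (2 * Δ + 1) fun i => if i = 0 then m 0 else (m 0).rev).bind fun y =>
  (detect ℓ (sampleLabels B k smp)).bind fun est₁ =>
  (flood ℓ (farCode B k n P id est₁)).bind fun x =>
  (detect ℓ (farLabels B P id x)).bind fun est₂ =>
  (detect ℓ {l | l = Fin.ofNat B id ∧ Selected P id smp x est₂}).bind fun est₃ =>
  (echo ℓ est₃ fun l => Fin.ofNat B (min (est₃ l) n).toNat).bind fun A =>
  (detect ℓ {l | Selected P id smp x est₂ ∧
    l = Fin.ofNat B (A (Fin.ofNat B id) * P + id)}).bind fun est₄ =>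
  open Classical in
  ret (if y (Fin.last k) = (y 0).rev then some (finalEstimate k P est₄) else none)

/-- The number of rounds of `attempt`. -/
def attemptRounds (Δ ℓ : ℕ) : ℕ := Δ + (2 * Δ + 1) + 6 * ℓ

variable {B k n P} {V : Type} {G : SimpleGraph V}

-- The round count and the acceptance test hold for every guess and every sample. The intermediate
-- results are only named here; they have a meaning once `ℓ` is large enough.
open Classical in
theorem computes_attempt (hG : G.Connected) (hk : 1 ≤ k) (Δ ℓ : ℕ) (id : V → ℕ)
    (smp : V → ℕ → Prop) :
    ∃ (est₁ : V → Fin B → ℕ∞) (x : V → Fin (k + 1) → Fin B) (est₂ est₃ : V → Fin B → ℕ∞)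
      (A : V → Fin B → Fin B) (est₄ : V → Fin B → ℕ∞),
      est₁ = detectState (k + 1) G (fun v => sampleLabels B k (smp v)) ℓ ∧
      (x = fun v => ⨆ u, ⨆ _ : G.dist v u ≤ ℓ, farCode B k n P (id u) (est₁ u)) ∧
      est₂ = detectState (k + 1) G (fun v => farLabels B P (id v) (x v)) ℓ ∧
      est₃ = detectState (k + 1) G (fun v => {l | l = Fin.ofNat B (id v) ∧
        Selected P (id v) (smp v) (x v) (est₂ v)}) ℓ ∧
      A = echoState (k + 1) G ℓ est₃ (fun v l => Fin.ofNat B (min (est₃ v l) n).toNat) ℓ ∧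
      est₄ = detectState (k + 1) G (fun v => {l | Selected P (id v) (smp v) (x v) (est₂ v) ∧
        l = Fin.ofNat B (A v (Fin.ofNat B (id v)) * P + id v)}) ℓ ∧
      Computes G (attemptRounds Δ ℓ) (fun v => attempt B k n P Δ ℓ (id v) (smp v)) fun v =>
        if Passes G Δ (fun u => Fin.ofNat B (id u)) v then some (finalEstimate k P (est₄ v))
        else none := by
  refine ⟨_, _, _, _, _, _, rfl, rfl, rfl, rfl, rfl, rfl, ?_⟩
  have hr : attemptRounds Δ ℓ =
    Δ + (2 * Δ + 1 + (ℓ + (ℓ + (ℓ + (ℓ + (ℓ + (ℓ + 0))))))) := by unfold attemptRounds; ring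
  rw [hr]
  unfold attempt
  refine (computes_flood hG Δ _).bind ?_
  refine (computes_flood hG (2 * Δ + 1) _).bind ?_
  refine (computes_detect ℓ _).bind ?_
  refine (computes_flood hG ℓ _).bind ?_
  refine (computes_detect ℓ _).bind ?_
  refine (computes_detect ℓ _).bind ?_
  refine (computes_echo ℓ _ _).bind ?_
  refine (computes_detect ℓ _).bind ?_
  refine (congrArg (Computes G 0 · _) (funext fun v => ?_)).mpr (computes_ret G _)
  refine congrArg ret (if_congr ?_ rfl rfl)
  -- Coordinate 0 carries the maximum and the last one the reversed minimum; they differ because `1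
  -- ≤ k`.
  have hlast : Fin.last k ≠ 0 := fun h => by simp [Fin.ext_iff] at h; omega
  simp only [iSup_apply, if_true, if_neg hlast]
  exact ballMax_eq_rev_iff (T := 2 * Δ + 1) (f := ballMax G Δ fun u => Fin.ofNat B (id u))

end Attempt

theorem val_ofNat_of_lt {B x : ℕ} [NeZero B] (h : x < B) : (Fin.ofNat B x : ℕ) = x :=
  Nat.mod_eq_of_lt h

theorem iSup_ofNat {V : Type} [Finite V] {B : ℕ} [NeZero B] {f : V → ℕ} (hf : ∀ u, f u < B) {w : V}
    (hw : ∀ u, f u ≤ f w) : ⨆ u, Fin.ofNat B (f u) = Fin.ofNat B (f w) := by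
  refine le_antisymm (iSup_le fun u => ?_) (le_iSup (fun u => Fin.ofNat B (f u)) w)
  rw [Fin.le_def, val_ofNat_of_lt (hf u), val_ofNat_of_lt (hf w)]
  exact hw u

theorem labelDist_unique {V L : Type} {G : SimpleGraph V} {src : V → Set L} {l : L} {z : V}
    (h : ∀ u, l ∈ src u ↔ u = z) (v : V) : labelDist G src v l = G.dist v z := by
  refine le_antisymm (labelDist_le ((h z).2 rfl) v) ?_
  refine le_iInf₂ fun u hu => ?_
  rw [(h u).1 hu]

theorem ncard_labels_le {V L : Type} [Finite V] (f : V → L) (S : Set V) {src : V → Set L}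
    (h : ∀ u, ∀ l ∈ src u, l = f u ∧ u ∈ S) : {l | ∃ u, l ∈ src u}.ncard ≤ S.ncard := by
  refine (Set.ncard_le_ncard (t := f '' S) ?_ (Set.toFinite _)).trans
    (Set.ncard_image_le (Set.toFinite _))
  rintro l ⟨u, hu⟩
  obtain ⟨rfl, hS⟩ := h u l hu
  exact ⟨u, hS, rfl⟩

theorem code_div {P e z : ℕ} (h : z < P) : (e * P + z) / P = e := by
  rw [Nat.add_comm, Nat.add_mul_div_right _ _ (by omega), Nat.div_eq_of_lt h, Nat.zero_add]

theorem code_mod {P e z : ℕ} (h : z < P) : (e * P + z) % P = z := by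
  rw [Nat.add_comm, Nat.add_mul_mod_self_right, Nat.mod_eq_of_lt h]

theorem code_lt {P e z n B : ℕ} (h : z < P) (he : e ≤ n) (hB : (n + 1) * P ≤ B) :
    e * P + z < B := by
  have := Nat.mul_le_mul_right P he
  rw [Nat.add_mul] at hB
  omega

/-! ### Reading the estimates off the last detection -/

section Final

variable {B k n P : ℕ} [NeZero B] {G : SimpleGraph (Fin n)}

theorem finalEstimate_approximates (hG : G.Connected) {S : Set (Fin n)} {w : ℕ → Fin n}
    {h : ℕ → ℕ} (hS : Skeleton G k S w h) {id : Fin n → ℕ} (hid : Function.Injective id)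
    (hP : ∀ v, id v < P) (hB : (n + 1) * P ≤ B) {est : Fin n → Fin B → ℕ∞}
    (hest : est = labelDist G fun v => {l | v ∈ S ∧ l = Fin.ofNat B (ecc G v * P + id v)}) :
    ∃ (d r : ℕ) (e : Fin n → ℕ), (∀ v, finalEstimate k P (est v) = ⟨d, r, e v⟩) ∧
      Approximates (2 - 1 / 2 ^ k) 3 d G.diam ∧
      Approximates (2 - 1 / 2 ^ k) 3 r G.radius.toNat ∧
      ∀ v, Approximates (3 - 4 / (2 ^ k + 1)) 3 (e v) (G.eccent v).toNat := by
  subst hest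
  set src : Fin n → Set (Fin B) := fun v => {l | v ∈ S ∧ l = Fin.ofNat B (ecc G v * P + id v)}
  set c : Fin n → Fin B := fun v => Fin.ofNat B (ecc G v * P + id v) with hc
  have hn : ∀ v, ecc G v ≤ n := by
    intro v
    obtain ⟨u, hu⟩ := exists_dist_eq_ecc hG v
    exact hu ▸ (dist_lt_card hG v u).le
  have hcv : ∀ v, (c v : ℕ) = ecc G v * P + id v := fun v =>
    val_ofNat_of_lt (code_lt (hP v) (hn v) hB)
  have hcd : ∀ v, (c v : ℕ) / P = ecc G v := fun v => by rw [hcv, code_div (hP v)]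
  have hci : Function.Injective c := by
    intro u v huv
    have := congrArg (fun x : Fin B => (x : ℕ) % P) huv
    simp only [hcv, code_mod (hP _)] at this
    exact hid this
  have hset : ∀ v, {l : Fin B | labelDist G src v l ≠ ⊤} = c '' S := by
    intro v
    ext l
    simp only [Set.mem_ofPred_eq, ne_eq, labelDist_eq_top, not_forall, not_not]
    constructor
    · rintro ⟨u, hu, rfl⟩; exact ⟨u, hu, rfl⟩
    · rintro ⟨u, hu, rfl⟩; exact ⟨u, hu, rfl⟩
  -- The label of `z` packs its eccentricity with its identifier. Labels are thus unique, and
  -- detecting one reveals both the distance to `z` and `ecc G z`.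
  have hld : ∀ z ∈ S, ∀ v, labelDist G src v (c z) = G.dist v z := by
    intro z hz v
    refine labelDist_unique (fun u => ⟨fun hu => (hci hu.2).symm, ?_⟩) v
    rintro rfl
    exact ⟨hz, rfl⟩
  obtain ⟨z₀, hz₀, -⟩ := hS.cover (w 0)
  have hne : (ecc G '' S).Nonempty := ⟨_, z₀, hz₀, rfl⟩
  have hfin : (ecc G '' S).Finite := Set.toFinite _
  have himg : ∀ v, (fun l : Fin B => (l : ℕ) / P) '' {l : Fin B | labelDist G src v l ≠ ⊤} =
      ecc G '' S := by
    intro v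
    rw [hset, Set.image_image]
    exact Set.image_congr fun z _ => hcd z
  have himg' : ∀ v, (fun l : Fin B => max (labelDist G src v l).toNat
      ((l : ℕ) / P - (labelDist G src v l).toNat)) '' {l : Fin B | labelDist G src v l ≠ ⊤} =
      (fun z => max (G.dist v z) (ecc G z - G.dist v z)) '' S := by
    intro v
    rw [hset, Set.image_image]
    refine Set.image_congr fun z hz => ?_
    rw [hld z hz, hcd, ENat.toNat_natCast]
  refine ⟨sSup (ecc G '' S), (sInf (ecc G '' S) - 1) * 2 ^ k / (2 * 2 ^ k - 1),
    fun v => sSup ((fun z => max (G.dist v z) (ecc G z - G.dist v z)) '' S), fun v => ?_, ?_, ?_,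
    fun v => ?_⟩
  · simp only [finalEstimate, himg, himg']
  · refine hS.approximates_diam hG (fun z hz => le_csSup hfin.bddAbove ⟨z, hz, rfl⟩) ?_
    obtain ⟨z, -, hz⟩ := Nat.sSup_mem hne hfin.bddAbove
    exact ⟨z, hz⟩
  · refine hS.approximates_radius hG (fun z hz => Nat.sInf_le ⟨z, hz, rfl⟩) ?_
    obtain ⟨z, -, hz⟩ := Nat.sInf_mem hne
    exact ⟨z, hz⟩
  · have hfin' : ((fun z => max (G.dist v z) (ecc G z - G.dist v z)) '' S).Finite := Set.toFinite _
    have hle : ∀ z ∈ S, max (G.dist v z) (ecc G z - G.dist v z) ≤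
        sSup ((fun z => max (G.dist v z) (ecc G z - G.dist v z)) '' S) := fun z hz =>
      le_csSup hfin'.bddAbove ⟨z, hz, rfl⟩
    refine hS.approximates_ecc hG (fun z hz => ?_) (fun z hz => ?_) ?_
    · rw [SimpleGraph.dist_comm]
      exact (le_max_left _ _).trans (hle z hz)
    · rw [G.dist_comm (u := z)]
      exact Nat.sub_le_iff_le_add.1 ((le_max_right _ _).trans (hle z hz))
    · obtain ⟨z, hz, he⟩ := Nat.sSup_mem (Set.Nonempty.image _ ⟨z₀, hz₀⟩) hfin'.bddAbove
      refine le_of_eq_of_le he.symm ?_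
      obtain ⟨u, hu⟩ := exists_dist_eq_ecc hG z
      have h1 := dist_le_ecc hG v z
      have h2 := dist_le_ecc hG v u
      have h3 := hG.dist_triangle (u := z) (v := v) (w := u)
      rw [G.dist_comm (u := z) (v := v)] at h3
      simp only []
      omega

end Final

/-! ### Correctness for good samples and a large enough guess -/

section Correct

variable {B k n P : ℕ} [NeZero B] {G : SimpleGraph (Fin n)}

/-- The samples are sparse in the balls that miss the next sample. -/
structure Sparse (G : SimpleGraph (Fin n)) (k M : ℕ) (smp : Fin n → ℕ → Prop) : Prop where
  zero : ∀ v, smp v 0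
  ball : ∀ w, ∀ j ≤ n, ∀ i < k, (∀ v, G.dist v w < j → ¬ smp v (i + 1)) →
    {v | G.dist v w < j ∧ smp v i}.ncard ≤ M
  last : {v | smp v k}.ncard ≤ M

/-- The distance from `v` to the `i`-th sample, truncated at `n`. -/
noncomputable def sampleDist (B k : ℕ) [NeZero B] (G : SimpleGraph (Fin n)) (smp : Fin n → ℕ → Prop)
    (i : ℕ) (v : Fin n) : ℕ :=
  (min (labelDist G (fun v => sampleLabels B k (smp v)) v (Fin.ofNat B i)) n).toNat

variable {smp : Fin n → ℕ → Prop}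

theorem mem_sampleLabels (hkB : k < B) {i : ℕ} (hi : i ≤ k) (v : Fin n) :
    Fin.ofNat B i ∈ sampleLabels B k (smp v) ↔ smp v i := by
  constructor
  · rintro ⟨j, hj, hs, he⟩
    have := congrArg Fin.val he
    rw [val_ofNat_of_lt (by omega), val_ofNat_of_lt (by omega)] at this
    rwa [this]
  · exact fun h => ⟨i, hi, h, rfl⟩

theorem sampleDist_le (i : ℕ) (v : Fin n) : sampleDist B k G smp i v ≤ n :=
  ENat.toNat_le_of_le_natCast (min_le_right _ _)

theorem sampleDist_le_dist (hkB : k < B) {i : ℕ} (hi : i ≤ k) {v z : Fin n} (hz : smp z i) :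
    sampleDist B k G smp i v ≤ G.dist v z :=
  ENat.toNat_le_of_le_natCast ((min_le_left _ _).trans
    (labelDist_le (src := fun v => sampleLabels B k (smp v))
      ((mem_sampleLabels hkB hi z).2 hz) v))

theorem exists_dist_eq_sampleDist (hkB : k < B) {i : ℕ} (hi : i ≤ k) {v : Fin n}
    (h : sampleDist B k G smp i v < n) : ∃ z, smp z i ∧ G.dist v z = sampleDist B k G smp i v := by
  unfold sampleDist at h ⊢
  set δ := labelDist G (fun v => sampleLabels B k (smp v)) v (Fin.ofNat B i) with hδ
  have hlt : δ < n := by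
    by_contra hc
    rw [min_eq_right (not_lt.1 hc)] at h
    simp at h
  obtain ⟨z, hz, he⟩ := exists_labelDist (hlt.trans_le le_top).ne
  rw [min_eq_left hlt.le]
  refine ⟨z, (mem_sampleLabels hkB hi z).1 hz, ?_⟩
  rw [hδ, he, ENat.toNat_natCast]

theorem attempt_correct (hG : G.Connected) (hk : 1 ≤ k) (hkB : k < B) {id : Fin n → ℕ}
    (hid : Function.Injective id) (hP : ∀ v, id v < P) (hB : (n + 1) * P ≤ B) {M ℓ : ℕ}
    (hsmp : Sparse G k M smp) (hℓ : G.diam + (k + 1) * (M + 1) ≤ ℓ)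
    {est₁ : Fin n → Fin B → ℕ∞} {x : Fin n → Fin (k + 1) → Fin B} {est₂ est₃ : Fin n → Fin B → ℕ∞}
    {A : Fin n → Fin B → Fin B} {est₄ : Fin n → Fin B → ℕ∞}
    (h₁ : est₁ = detectState (k + 1) G (fun v => sampleLabels B k (smp v)) ℓ)
    (hx : x = fun v => ⨆ u, ⨆ _ : G.dist v u ≤ ℓ, farCode B k n P (id u) (est₁ u))
    (h₂ : est₂ = detectState (k + 1) G (fun v => farLabels B P (id v) (x v)) ℓ)
    (h₃ : est₃ = detectState (k + 1) G (fun v => {l | l = Fin.ofNat B (id v) ∧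
        Selected P (id v) (smp v) (x v) (est₂ v)}) ℓ)
    (hA : A = echoState (k + 1) G ℓ est₃ (fun v l => Fin.ofNat B (min (est₃ v l) n).toNat) ℓ)
    (h₄ : est₄ = detectState (k + 1) G (fun v => {l | Selected P (id v) (smp v) (x v) (est₂ v) ∧
        l = Fin.ofNat B (A v (Fin.ofNat B (id v)) * P + id v)}) ℓ) :
    ∃ (d r : ℕ) (e : Fin n → ℕ), (∀ v, finalEstimate k P (est₄ v) = ⟨d, r, e v⟩) ∧
      Approximates (2 - 1 / 2 ^ k) 3 d G.diam ∧
      Approximates (2 - 1 / 2 ^ k) 3 r G.radius.toNat ∧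
      ∀ v, Approximates (3 - 4 / (2 ^ k + 1)) 3 (e v) (G.eccent v).toNat := by
  have hne := hG.nonempty
  have hP0 : 0 < P := (Nat.zero_le _).trans_lt (hP hne.some)
  have hnB : n < B := by
    have := Nat.le_mul_of_pos_right (n + 1) hP0
    omega
  have hdB : ∀ v u, G.dist v u < B := fun v u => (dist_lt_card hG v u).trans hnB
  have hidB : ∀ v, id v < B := fun v => by
    have := Nat.le_mul_of_pos_left P (show 0 < n + 1 by omega)
    have := hP v
    omega
  have hil : ∀ u v, Fin.ofNat B (id u) = Fin.ofNat B (id v) ↔ u = v := by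
    intro u v
    refine ⟨fun h => hid ?_, fun h => by rw [h]⟩
    have := congrArg Fin.val h
    rwa [val_ofNat_of_lt (hidB u), val_ofNat_of_lt (hidB v)] at this
  have hkM : k + 1 ≤ (k + 1) * (M + 1) := Nat.le_mul_of_pos_right _ (Nat.succ_pos M)
  -- distances to the samples
  have hen₁ : Enough G (fun v => sampleLabels B k (smp v)) ℓ := by
    refine enough_of_card hG (K := k + 1) ?_ hdB (by omega)
    refine (Set.ncard_le_ncard (t := Fin.ofNat B '' Set.Iio (k + 1)) ?_
      (Set.toFinite _)).trans ((Set.ncard_image_le (Set.toFinite _)).trans ?_)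
    · rintro l ⟨u, i, hi, -, rfl⟩
      exact ⟨i, Nat.lt_succ_of_le hi, rfl⟩
    · rw [Set.ncard_eq_toFinset_card']; simp
  rw [detectState_eq_labelDist hG hen₁] at h₁
  set H := sampleDist B k G smp with hH
  -- With the distance as leading digit and the identifier as last digit, the flooded maximum
  -- determines both the largest distance to the sample and a single node attaining it.
  set f : ℕ → Fin n → ℕ := fun i u => H i u * P + id u with hf
  have hfB : ∀ i u, f i u < B := fun i u => code_lt (hP u) (sampleDist_le i u) hB
  have hW : ∀ i, ∃ w, ∀ u, f i u ≤ f i w := fun i => Finite.exists_max (f i)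
  choose W hW using hW
  have hHW : ∀ i u, H i u ≤ H i (W i) := by
    intro i u
    have := Nat.div_le_div_right (c := P) (hW i u)
    simpa only [hf, code_div (hP _)] using this
  have hxW : ∀ v (i : Fin (k + 1)), (x v i : ℕ) = f i (W i) := by
    intro v i
    have hle : ∀ u, G.dist v u ≤ ℓ := fun u => (dist_le_diam hG v u).trans (by omega)
    rw [hx]
    simp only [iSup_apply, hle, iSup_pos]
    rw [← val_ofNat_of_lt (hfB i (W i)), ← iSup_ofNat (hfB i) (hW i), h₁]
    rfl
  have hxm : ∀ v (i : Fin k), (x v i.succ : ℕ) % P = id (W (i + 1)) := fun v i => by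
    rw [hxW, code_mod (hP _)]; rfl
  have hxd : ∀ v (i : Fin k), (x v i.succ : ℕ) / P = H (i + 1) (W (i + 1)) := fun v i => by
    rw [hxW, code_div (hP _)]; rfl
  -- distances to the far nodes
  have hsrc₂ : ∀ v, farLabels B P (id v) (x v) =
      {l | l = Fin.ofNat B (id v) ∧ ∃ i : Fin k, v = W (i + 1)} := by
    intro v
    unfold farLabels
    simp only [hxm, hid.eq_iff]
  simp only [hsrc₂] at h₂
  rw [detectState_eq_labelDist hG (enough_of_card hG (K := k + 1) (le_trans
    (ncard_labels_le (fun v => Fin.ofNat B (id v)) (Set.range fun i : Fin k => W (i + 1))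
      fun u l hl => ⟨hl.1, hl.2.imp fun _ h => h.symm⟩) (le_trans (by
        rw [← Set.image_univ]
        refine (Set.ncard_image_le (Set.toFinite _)).trans ?_
        rw [Set.ncard_univ, Nat.card_eq_fintype_card, Fintype.card_fin]) (Nat.le_succ k)))
    hdB (by omega))] at h₂
  have he₂ : ∀ v (i : Fin k), est₂ v (Fin.ofNat B (id (W (i + 1)))) = G.dist v (W (i + 1)) := by
    intro v i
    rw [h₂]
    refine labelDist_unique (fun u => ⟨fun hu => ((hil _ _).1 hu.1).symm, ?_⟩) v
    rintro rfl
    exact ⟨rfl, i, rfl⟩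
  -- the skeleton
  set S : Set (Fin n) := {v | smp v k ∨ ∃ i : Fin k, v = W (i + 1) ∨
    (smp v i ∧ G.dist v (W (i + 1)) < H (i + 1) (W (i + 1)))} with hSdef
  have hsel : ∀ v, Selected P (id v) (smp v) (x v) (est₂ v) ↔ v ∈ S := by
    intro v
    simp only [Selected, hxm, hxd, he₂, hid.eq_iff, Nat.cast_lt, hSdef, Set.mem_ofPred_eq]
  simp only [hsel] at h₃ h₄
  have hskel : Skeleton G k S W fun i => H i (W i) := by
    refine ⟨?_, fun i hi => Or.inr ⟨⟨i, hi⟩, Or.inl rfl⟩, fun i hi y hy => ?_, fun y => ?_⟩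
    · have := sampleDist_le_dist (G := G) hkB (Nat.zero_le k) (v := W 0) (hsmp.zero (W 0))
      rw [SimpleGraph.dist_self] at this
      exact Nat.le_zero.1 this
    · have h1 := hHW i y
      have h2 : H (i + 1) (W (i + 1)) ≤ n := sampleDist_le _ _
      obtain ⟨z, hz, hd⟩ := exists_dist_eq_sampleDist (G := G) hkB hi.le (v := y) (smp := smp)
        (show H i y < n by omega)
      change G.dist y z = H i y at hd
      rw [SimpleGraph.dist_comm] at hd
      -- The sample node `z` nearest to `y` lies in the open ball about `W (i + 1)` by the triangle
      -- inequality, so it was selected.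
      refine ⟨z, Or.inr ⟨⟨i, hi⟩, Or.inr ⟨hz, ?_⟩⟩, by omega⟩
      have := hG.dist_triangle (u := z) (v := y) (w := W (i + 1))
      rw [G.dist_comm (u := y)] at this
      simp only at hy ⊢
      omega
    · by_cases hlt : H k (W k) < n
      · have h1 := hHW k y
        obtain ⟨z, hz, hd⟩ := exists_dist_eq_sampleDist (G := G) hkB le_rfl (v := y) (smp := smp)
          (show H k y < n by omega)
        change G.dist y z = H k y at hd
        rw [SimpleGraph.dist_comm] at hd
        exact ⟨z, Or.inl hz, by omega⟩
      -- Here the truncated distance is `n`, which exceeds every distance in the graph, so any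
      -- skeleton node covers `y`.
      · refine ⟨W 1, Or.inr ⟨⟨0, hk⟩, Or.inl rfl⟩, ?_⟩
        have := dist_lt_card hG (W 1) y
        omega
  have hcard : S.ncard ≤ (k + 1) * (M + 1) := by
    have hsub : S ⊆ {v | smp v k} ∪ ⋃ i : Fin k, ({W (i + 1)} ∪
        {v | G.dist v (W (i + 1)) < H (i + 1) (W (i + 1)) ∧ smp v i}) := by
      rintro v (hv | ⟨i, hv | hv⟩)
      · exact Or.inl hv
      · exact Or.inr (Set.mem_iUnion.2 ⟨i, Or.inl hv⟩)
      · exact Or.inr (Set.mem_iUnion.2 ⟨i, Or.inr hv.symm⟩)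
    have hi : ∀ i : Fin k, ({W (i + 1)} ∪
        {v | G.dist v (W (i + 1)) < H (i + 1) (W (i + 1)) ∧ smp v i}).ncard ≤ M + 1 := by
      intro i
      refine (Set.ncard_union_le _ _).trans ?_
      rw [Set.ncard_singleton, Nat.add_comm]
      -- The open ball whose radius is the distance from its centre to the next sample misses that
      -- sample.
      refine Nat.add_le_add_right (hsmp.ball _ _ (sampleDist_le _ _) i i.2 fun v hv hs => ?_) 1
      have := sampleDist_le_dist (G := G) hkB i.2 (v := W (i + 1)) hs
      rw [SimpleGraph.dist_comm] at this
      exact absurd hv (not_lt.2 this)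
    calc S.ncard ≤ _ := Set.ncard_le_ncard hsub (Set.toFinite _)
      _ ≤ M + ∑ i : Fin k, (M + 1) := by
        refine (Set.ncard_union_le _ _).trans (Nat.add_le_add hsmp.last ?_)
        refine le_trans ?_ (Finset.sum_le_sum fun i _ => hi i)
        have := Set.ncard_iUnion_le_of_fintype fun i : Fin k => ({W (i + 1)} ∪
          {v | G.dist v (W (i + 1)) < H (i + 1) (W (i + 1)) ∧ smp v i})
        exact this
      _ ≤ _ := by
        simp only [Finset.sum_const, Finset.card_univ, Fintype.card_fin, smul_eq_mul]
        rw [Nat.add_mul k 1]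
        omega
  -- eccentricities of the nodes of the skeleton
  have hen₃ : Enough G (fun v => {l : Fin B | l = Fin.ofNat B (id v) ∧ v ∈ S}) ℓ :=
    enough_of_card hG ((ncard_labels_le (fun v => Fin.ofNat B (id v)) S
      fun u l hl => hl).trans hcard) hdB hℓ
  rw [detectState_eq_labelDist hG hen₃] at h₃
  have hun : ∀ z ∈ S, ∀ u, Fin.ofNat B (id z) ∈ {l : Fin B | l = Fin.ofNat B (id u) ∧ u ∈ S} ↔
      u = z := by
    intro z hz u
    refine ⟨fun hu => ((hil _ _).1 hu.1).symm, ?_⟩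
    rintro rfl
    exact ⟨rfl, hz⟩
  have hAe : ∀ z ∈ S, (A z (Fin.ofNat B (id z)) : ℕ) = ecc G z := by
    intro z hz
    rw [hA, h₃, echoState_eq hG hen₃ (hun z hz)]
    have hd : ∀ u, (min (labelDist G (fun v => {l : Fin B | l = Fin.ofNat B (id v) ∧ v ∈ S}) u
        (Fin.ofNat B (id z))) n).toNat = G.dist z u := by
      intro u
      rw [labelDist_unique (hun z hz) u, min_eq_left, ENat.toNat_natCast, SimpleGraph.dist_comm]
      exact_mod_cast (dist_lt_card hG u z).le
    simp only [hd]
    obtain ⟨a, ha⟩ := exists_dist_eq_ecc hG z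
    rw [iSup_ofNat (hdB z) (w := a) fun u => ha ▸ dist_le_ecc hG z u, val_ofNat_of_lt (hdB z a), ha]
  have hsrc₄ : (fun v => {l | v ∈ S ∧ l = Fin.ofNat B (A v (Fin.ofNat B (id v)) * P + id v)}) =
      fun v => {l | v ∈ S ∧ l = Fin.ofNat B (ecc G v * P + id v)} := by
    funext v
    ext l
    exact and_congr_right fun hv => by rw [hAe v hv]
  rw [hsrc₄, detectState_eq_labelDist hG (enough_of_card hG
    ((ncard_labels_le (fun v => Fin.ofNat B (ecc G v * P + id v)) S
      fun u l hl => hl.symm).trans hcard) hdB hℓ)] at h₄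
  exact finalEstimate_approximates hG hskel hid hP hB h₄

end Correct

/-! ### Trying guesses in turn -/

section Search

variable {M O V : Type} {G : SimpleGraph V}

/-- Try the programs `att i` one after the other until one of them succeeds. -/
def search (att : ℕ → Prog M (Option O)) (dflt : O) : ℕ → ℕ → Prog M O
  | 0, _ => ret dflt
  | f + 1, i => (att i).bind fun r => r.elim (search att dflt f (i + 1)) ret

theorem computes_search {att : V → ℕ → Prog M (Option O)} {dflt : O} {T : ℕ → ℕ}
    {res : ℕ → V → Option O} (hatt : ∀ i, Computes G (T i) (fun v => att v i) (res i)) {j : ℕ}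
    {o : V → O} (hlt : ∀ i < j, ∀ v, res i v = none) (hj : ∀ v, res j v = some (o v)) {f : ℕ}
    (hf : j < f) :
    Computes G (∑ i ∈ Finset.range (j + 1), T i) (fun v => search (att v) dflt f 0) o := by
  have key : ∀ d s f, s + d = j → d < f →
      Computes G (∑ i ∈ Finset.Ico s (j + 1), T i) (fun v => search (att v) dflt f s) o := by
    intro d
    induction d with
    | zero =>
      rintro s (_ | f) hs hf
      · omega
      obtain rfl : s = j := hs
      rw [Finset.sum_Ico_succ_top le_rfl, Finset.Ico_self, Finset.sum_empty, Nat.zero_add]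
      refine (hatt s).bind (T' := 0) ?_
      simp only [hj]
      exact computes_ret G o
    | succ d ih =>
      rintro s (_ | f) hs hf
      · omega
      rw [Finset.sum_eq_sum_Ico_succ_bot (by omega)]
      refine (hatt s).bind ?_
      simp only [hlt s (by omega)]
      exact ih (s + 1) f (by omega) (by omega)
  rw [Finset.range_eq_Ico]
  exact key j 0 f (by omega) hf

end Search

/-! ### Choice of parameters -/

section Parameters

variable (k a c n : ℕ)

/-- Samples get sparser by the factor `2 ^ rate k n`, about `n ^ (1 / (k + 1))`. -/
def rate : ℕ := Nat.log 2 n / (k + 1) + 1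

/-- A factor that makes failures improbable. -/
def slack : ℕ := (c + k + 10) * (Nat.log 2 n + 1)

/-- A bound on the sizes of the sparse parts of the samples. -/
def sparseBound : ℕ := 3 * (2 ^ rate k n * slack k c n)

/-- A bound on the size of the skeleton. -/
def skeletonBound : ℕ := (k + 1) * (sparseBound k c n + 1)

/-- A bound on the numbers in messages. -/
def valueBound : ℕ := 2 ^ ((a + k + 2) * (Nat.log 2 n + 1))

instance : NeZero (valueBound k a n) := ⟨by unfold valueBound; positivity⟩

theorem succ_le_two_pow_log : n + 1 ≤ 2 ^ (Nat.log 2 n + 1) :=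
  Nat.lt_pow_succ_log_self (by norm_num) n

theorem code_le_valueBound : (n + 1) * n ^ a ≤ valueBound k a n := by
  have h := succ_le_two_pow_log n
  calc (n + 1) * n ^ a ≤ (n + 1) * (n + 1) ^ a := by gcongr; omega
    _ = (n + 1) ^ (a + 1) := by ring
    _ ≤ (2 ^ (Nat.log 2 n + 1)) ^ (a + 1) := by gcongr
    _ ≤ (2 ^ (Nat.log 2 n + 1)) ^ (a + k + 2) := Nat.pow_le_pow_right (by positivity) (by omega)
    _ = _ := by rw [valueBound, ← pow_mul, mul_comm]

theorem lt_valueBound : k < valueBound k a n := by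
  refine Nat.lt_two_pow_self.trans_le (Nat.pow_le_pow_right (by norm_num) ?_)
  have := Nat.le_mul_of_pos_right (a + k + 2) (show 0 < Nat.log 2 n + 1 by omega)
  omega

/-- A message consists of `k + 3` numbers of `(a + k + 2) * (Nat.log 2 n + 1)` bits each, which
exactly fills the bandwidth. -/
theorem exists_encoding : ∃ enc : Msg (valueBound k a n) (k + 1) →
    Message ((k + 3) * (a + k + 2)) n, Function.Injective enc := by
  have h : Fintype.card (Msg (valueBound k a n) (k + 1)) ≤
      Fintype.card (Message ((k + 3) * (a + k + 2)) n) := by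
    simp only [Fintype.card_prod, Fintype.card_fin, Fintype.card_fun, Fintype.card_bool]
    refine le_of_eq ?_
    calc _ = valueBound k a n ^ (k + 3) := by ring
      _ = _ := by rw [valueBound, ← pow_mul]; congr 1; ring
  obtain ⟨f⟩ := Function.Embedding.nonempty_of_card_le h
  exact ⟨f, f.injective⟩

/-- The program of a node. -/
noncomputable def nodeProg (id : ℕ) (x : Fin (k * rate k n) → Bool) :
    Prog (Msg (valueBound k a n) (k + 1)) Estimate :=
  search (fun i => attempt (valueBound k a n) k n (n ^ a) (2 ^ i) (2 * 2 ^ i + skeletonBound k c n)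
    id fun j => InSample (rate k n) j x) ⟨0, 0, 0⟩ (n + 1) 0

/-- The algorithm. -/
noncomputable def distanceAlgorithm : Algorithm Estimate :=
  progAlgorithm ((k + 3) * (a + k + 2)) (fun n => k * rate k n)
    (fun n => Msg (valueBound k a n) (k + 1)) (fun n => (exists_encoding k a n).choose)
    fun n => nodeProg k a c n

variable {k a c n}

theorem slack_pos : 0 < slack k c n := by unfold slack; positivity

theorem le_rate_pow : n ≤ (2 ^ rate k n) ^ (k + 1) * slack k c n := by
  have h1 : Nat.log 2 n + 1 ≤ rate k n * (k + 1) := by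
    have := Nat.lt_mul_div_succ (Nat.log 2 n) (Nat.succ_pos k)
    unfold rate
    rw [mul_comm]
    exact this
  calc n ≤ 2 ^ (Nat.log 2 n + 1) := (Nat.le_succ n).trans (succ_le_two_pow_log n)
    _ ≤ 2 ^ (rate k n * (k + 1)) := Nat.pow_le_pow_right (by norm_num) h1
    _ = (2 ^ rate k n) ^ (k + 1) := pow_mul _ _ _
    _ ≤ _ := Nat.le_mul_of_pos_right _ slack_pos

open Classical in
/-- The balls of a network. -/
noncomputable def balls (G : SimpleGraph (Fin n)) (τ : Fin n × Fin (n + 1)) : Finset (Fin n) :=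
  {v | G.dist v τ.1 < τ.2}

/-- A ball that misses sample `i + 1` cannot be large at that level, hence it has few nodes of
sample `i`. The last sample is bounded by taking the ball of radius `n`, which is the whole graph,
and `le_rate_pow`. -/
theorem sparse_of_goodSample {G : SimpleGraph (Fin n)} (hG : G.Connected)
    {ω : Fin n → Fin (k * rate k n) → Bool}
    (h : GoodSample k (rate k n) (slack k c n) (k * rate k n) (balls G) ω) :
    Sparse G k (sparseBound k c n) fun v j => InSample (rate k n) j (ω v) where
  zero v j hj := by omega
  ball w j hj i hi hmiss := by
    have h1 := (h (w, ⟨j, Nat.lt_succ_of_le hj⟩) (i + 1) hi).1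
    have h2 := (h (w, ⟨j, Nat.lt_succ_of_le hj⟩) i hi.le).2
    have h3 : ¬ (2 ^ rate k n) ^ (i + 1) * slack k c n ≤
        (balls G (w, ⟨j, Nat.lt_succ_of_le hj⟩)).card := by
      intro hle
      obtain ⟨v, hv, hs⟩ := h1 hle
      simp only [balls, Finset.mem_filter, Finset.mem_univ, true_and] at hv
      exact hmiss v hv hs
    simpa [balls, sparseBound] using h2 (not_le.1 h3).le
  last := by
    have hne := hG.nonempty
    have h2 := (h (hne.some, ⟨n, Nat.lt_succ_self n⟩) k le_rfl).2
      ((Finset.card_le_univ _).trans (by rw [Fintype.card_fin]; exact le_rate_pow))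
    simpa [balls, sparseBound, dist_lt_card hG] using h2

end Parameters

/-! ### Running time and success probability -/

section Main

variable {k a c n : ℕ}

theorem log_add_one_le (hn : 1 ≤ n) : (Nat.log 2 n : ℝ) + 1 ≤ 2 * (1 + Real.log n) := by
  have h1 : (2 : ℝ) ^ Nat.log 2 n ≤ n := by
    exact_mod_cast Nat.pow_log_le_self 2 (by omega)
  have h2 := Real.log_le_log (by positivity) h1
  rw [Real.log_pow] at h2
  have h3 := Real.log_two_gt_d9
  have h4 : (0 : ℝ) ≤ Nat.log 2 n := by positivity
  nlinarith

theorem two_pow_rate_le (hn : 1 ≤ n) :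
    (2 : ℝ) ^ rate k n ≤ 2 * (n : ℝ) ^ (1 / ((k : ℝ) + 1)) := by
  unfold rate
  rw [pow_succ, mul_comm]
  gcongr
  set x := Nat.log 2 n / (k + 1)
  have h1 : ((2 : ℝ) ^ x) ^ (k + 1) ≤ n := by
    rw [← pow_mul]
    have : 2 ^ (x * (k + 1)) ≤ n := (Nat.pow_le_pow_right (by norm_num)
      (Nat.div_mul_le_self _ _)).trans (Nat.pow_log_le_self 2 (by omega))
    exact_mod_cast this
  have h2 := Real.rpow_le_rpow (by positivity) h1 (show 0 ≤ 1 / ((k : ℝ) + 1) by positivity)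
  refine le_trans (le_of_eq ?_) h2
  have h3 := Real.pow_rpow_inv_natCast (show (0 : ℝ) ≤ 2 ^ x by positivity) (Nat.succ_ne_zero k)
  rw [one_div, ← Nat.cast_succ]
  exact h3.symm

/-- The constant in the bound on the number of rounds. -/
def timeConst (k c : ℕ) : ℕ := 60 + 3 * (6 * ((k + 1) * (12 * (c + k + 10) + 1)) + 1)

/-- The guesses form a geometric series of sum `O(D + 1)`, with `15 * 4 = 60` in front. The skeleton
term recurs once per guess; one logarithm comes from the number of guesses, the other from `slack`.
-/
theorem rounds_le (hn : 1 ≤ n) {D j : ℕ} (hD : D ≤ n) (hj : j ≤ Nat.log 2 D + 1) :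
    ((∑ i ∈ Finset.range (j + 1), attemptRounds (2 ^ i) (2 * 2 ^ i + skeletonBound k c n) : ℕ) : ℝ) ≤
      timeConst k c * ((n : ℝ) ^ (1 / ((k : ℝ) + 1)) + D) * (1 + Real.log n) ^ 2 := by
  have h1 : ∑ i ∈ Finset.range (j + 1), attemptRounds (2 ^ i) (2 * 2 ^ i + skeletonBound k c n) ≤
      60 * (D + 1) + (Nat.log 2 n + 2) * (6 * skeletonBound k c n + 1) := by
    have e1 : ∀ i, attemptRounds (2 ^ i) (2 * 2 ^ i + skeletonBound k c n) =
        15 * 2 ^ i + (6 * skeletonBound k c n + 1) := by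
      intro i; unfold attemptRounds; ring
    rw [Finset.sum_congr rfl fun i _ => e1 i, Finset.sum_add_distrib, ← Finset.mul_sum,
      Finset.sum_const, Finset.card_range, smul_eq_mul]
    have e2 : ∑ i ∈ Finset.range (j + 1), 2 ^ i ≤ 4 * (D + 1) := by
      have : ∑ i ∈ Finset.range (j + 1), 2 ^ i < 2 ^ (j + 1) := by
        have := Nat.geomSum_lt (m := 2) (n := j + 1) (s := Finset.range (j + 1)) le_rfl
          fun i hi => Finset.mem_range.1 hi
        exact this
      have e3 : 2 ^ (j + 1) ≤ 2 ^ (Nat.log 2 D) * 4 := by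
        calc 2 ^ (j + 1) ≤ 2 ^ (Nat.log 2 D + 2) := Nat.pow_le_pow_right (by norm_num) (by omega)
          _ = _ := by rw [pow_add]; norm_num
      have e4 : 2 ^ Nat.log 2 D ≤ D + 1 := by
        rcases Nat.eq_zero_or_pos D with h | h
        · simp [h]
        · exact (Nat.pow_log_le_self 2 h.ne').trans (Nat.le_succ D)
      omega
    have e5 : Nat.log 2 D ≤ Nat.log 2 n := Nat.log_mono_right hD
    have e6 : (j + 1) * (6 * skeletonBound k c n + 1) ≤
        (Nat.log 2 n + 2) * (6 * skeletonBound k c n + 1) := Nat.mul_le_mul_right _ (by omega)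
    omega
  set ρ := (n : ℝ) ^ (1 / ((k : ℝ) + 1)) with hρ
  set lam := 1 + Real.log n with hlam
  have hρ1 : 1 ≤ ρ := Real.one_le_rpow (by exact_mod_cast hn) (by positivity)
  have hlam1 : 1 ≤ lam := by
    have := Real.log_nonneg (show (1 : ℝ) ≤ n by exact_mod_cast hn)
    linarith
  have h2 := log_add_one_le hn
  have h3 := two_pow_rate_le (k := k) hn
  rw [← hlam] at h2
  rw [← hρ] at h3
  have hρlam : 1 ≤ ρ * lam := one_le_mul_of_one_le_of_one_le hρ1 hlam1
  have h4 : (skeletonBound k c n : ℝ) ≤ (k + 1) * (12 * (c + k + 10) + 1) * (ρ * lam) := by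
    have e1 : (2 : ℝ) ^ rate k n * (Nat.log 2 n + 1) ≤ 2 * ρ * (2 * lam) := by gcongr
    have e2 : (3 * (2 ^ rate k n * ((c + k + 10) * ((Nat.log 2 n : ℝ) + 1))) + 1 : ℝ) ≤
        (12 * (c + k + 10) + 1) * (ρ * lam) := by
      calc (3 * (2 ^ rate k n * ((c + k + 10) * ((Nat.log 2 n : ℝ) + 1))) + 1 : ℝ)
          = 3 * (c + k + 10) * (2 ^ rate k n * (Nat.log 2 n + 1)) + 1 := by ring
        _ ≤ 3 * (c + k + 10) * (2 * ρ * (2 * lam)) + ρ * lam := by gcongr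
        _ = _ := by ring
    unfold skeletonBound sparseBound slack
    push_cast
    rw [mul_assoc]
    gcongr
  have h5 : (6 * skeletonBound k c n + 1 : ℝ) ≤
      (6 * ((k + 1) * (12 * (c + k + 10) + 1)) + 1) * (ρ * lam) := by
    calc (6 * skeletonBound k c n + 1 : ℝ)
        ≤ 6 * ((k + 1) * (12 * (c + k + 10) + 1) * (ρ * lam)) + ρ * lam := by gcongr
      _ = _ := by ring
  have h6 : (Nat.log 2 n : ℝ) + 2 ≤ 3 * lam := by linarith
  have hlam2 : 1 ≤ lam ^ 2 := one_le_pow₀ hlam1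
  calc _ ≤ ((60 * (D + 1) + (Nat.log 2 n + 2) * (6 * skeletonBound k c n + 1) : ℕ) : ℝ) := by
        exact_mod_cast h1
    _ = 60 * ((1 : ℝ) + D) * 1 + (Nat.log 2 n + 2) * (6 * skeletonBound k c n + 1) := by
        push_cast; ring
    _ ≤ 60 * (ρ + D) * lam ^ 2 +
        (3 * lam) * ((6 * ((k + 1) * (12 * (c + k + 10) + 1)) + 1) * (ρ * lam)) := by gcongr
    _ = 60 * (ρ + D) * lam ^ 2 +
        3 * (6 * ((k + 1) * (12 * (c + k + 10) + 1)) + 1) * (ρ + 0) * lam ^ 2 := by ring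
    _ ≤ 60 * (ρ + D) * lam ^ 2 +
        3 * (6 * ((k + 1) * (12 * (c + k + 10) + 1)) + 1) * (ρ + D) * lam ^ 2 := by
        gcongr
        positivity
    _ = _ := by unfold timeConst; push_cast; ring

theorem failure_le (hn : 1 ≤ n) :
    (n : ℝ) * (n + 1) * (k + 1) * 2 * n ^ c ≤ 2 ^ slack k c n := by
  have h : n * (n + 1) * (k + 1) * 2 * n ^ c ≤ 2 ^ slack k c n := by
    calc n * (n + 1) * (k + 1) * 2 * n ^ c
        ≤ (n + 1) * (n + 1) * (n + 1) ^ k * (n + 1) ^ 8 * (n + 1) ^ c := by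
          have h1 : k + 1 ≤ (n + 1) ^ k :=
            (Nat.succ_le_of_lt Nat.lt_two_pow_self).trans (Nat.pow_le_pow_left (by omega) k)
          have h2 : 2 ≤ (n + 1) ^ 8 :=
            le_trans (by norm_num) (Nat.pow_le_pow_left (show 2 ≤ n + 1 by omega) 8)
          gcongr <;> omega
      _ = (n + 1) ^ (c + k + 10) := by ring
      _ ≤ (2 ^ (Nat.log 2 n + 1)) ^ (c + k + 10) := by
          gcongr; exact succ_le_two_pow_log n
      _ = _ := by rw [slack, ← pow_mul, mul_comm]
  exact_mod_cast h

theorem one_le_of_network (N : Network n a) : 1 ≤ n := by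
  obtain ⟨v⟩ := N.connected.nonempty
  exact (Nat.zero_le _).trans_lt v.2

/-- The accepted guess `j` is fixed before `ω`, because the test involves identifiers only. So the
halting bound is certain, and good samples are needed only for the quality of the output. -/
theorem computes_nodeProg (hk : 1 ≤ k) (N : Network n a) :
    ∃ j ≤ Nat.log 2 N.graph.diam + 1, ∀ ω : Fin n → Fin (k * rate k n) → Bool,
      ∃ o : Fin n → Estimate,
        Computes N.graph (∑ i ∈ Finset.range (j + 1),
          attemptRounds (2 ^ i) (2 * 2 ^ i + skeletonBound k c n))
          (fun v => nodeProg k a c n (N.ident v) (ω v)) o ∧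
        (GoodSample k (rate k n) (slack k c n) (k * rate k n) (balls N.graph) ω →
          ∃ (d r : ℕ) (e : Fin n → ℕ), (∀ v, o v = ⟨d, r, e v⟩) ∧
            Approximates (2 - 1 / 2 ^ k) 3 d N.graph.diam ∧
            Approximates (2 - 1 / 2 ^ k) 3 r N.graph.radius.toNat ∧
            ∀ v, Approximates (3 - 4 / (2 ^ k + 1)) 3 (e v) (N.graph.eccent v).toNat) := by
  classical
  have hG := N.connected
  have hn := one_le_of_network N
  obtain ⟨v₀⟩ := hG.nonempty
  set f : Fin n → Fin (valueBound k a n) := fun u => Fin.ofNat _ (N.ident u) with hfdef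
  have hf : Function.Injective f := by
    intro u v huv
    have hlt : ∀ u, N.ident u < valueBound k a n := fun u => by
      have h1 := code_le_valueBound k a n
      have h2 := Nat.le_mul_of_pos_left (n ^ a) (show 0 < n + 1 by omega)
      have := N.ident_lt u
      omega
    have := congrArg Fin.val huv
    simp only [hfdef, val_ofNat_of_lt (hlt _)] at this
    exact N.ident_injective this
  have hex : ∃ i, Passes N.graph (2 ^ i) f v₀ :=
    ⟨Nat.log 2 N.graph.diam + 1, passes_of_diam_le hG
      (Nat.lt_pow_succ_log_self (by norm_num) _).le f v₀⟩
  have hfind := Nat.find_spec hex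
  have hmin : Nat.find hex ≤ Nat.log 2 N.graph.diam + 1 := Nat.find_min' hex (passes_of_diam_le hG
    (Nat.lt_pow_succ_log_self (by norm_num) _).le f v₀)
  -- The `n + 1` guesses of `search` suffice, since the diameter is below `2 ^ n`; its default
  -- output is never used.
  have hjn : Nat.find hex < n + 1 := by
    refine Nat.lt_succ_of_le (Nat.find_min' hex (passes_of_diam_le hG ?_ f v₀))
    have := hG.nonempty
    obtain ⟨x, y, hxy⟩ := SimpleGraph.exists_dist_eq_diam (G := N.graph)
    exact hxy ▸ (dist_lt_card hG x y).le.trans Nat.lt_two_pow_self.le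
  have hlt : ∀ i < Nat.find hex, ∀ v, ¬ Passes N.graph (2 ^ i) f v := fun i hi v hv =>
    Nat.find_min hex hi (hv.all hG hf v₀)
  set j := Nat.find hex
  refine ⟨j, hmin, fun ω => ?_⟩
  have hatt := fun i => computes_attempt (B := valueBound k a n) (n := n) (P := n ^ a) hG hk (2 ^ i)
    (2 * 2 ^ i + skeletonBound k c n) N.ident fun v l => InSample (rate k n) l (ω v)
  choose est₁ x est₂ est₃ A est₄ h₁ hx h₂ h₃ hA h₄ hC using hatt
  refine ⟨fun v => finalEstimate k (n ^ a) (est₄ j v), ?_, fun hgood => ?_⟩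
  · exact computes_search hC (fun i hi v => if_neg (hlt i hi v))
      (fun v => if_pos (hfind.all hG hf v)) hjn
  -- Acceptance only gives diameter at most twice the guess, hence the term `2 * 2 ^ i` in the
  -- length of the phases.
  · have hd := hfind.diam_le hG hf
    exact attempt_correct hG hk (lt_valueBound k a n) N.ident_injective N.ident_lt
      (code_le_valueBound k a n) (sparse_of_goodSample hG hgood)
      (Nat.add_le_add_right hd _) (h₁ j) (hx j) (h₂ j) (h₃ j) (hA j) (h₄ j)

theorem distanceAlgorithm_outputAt {N : Network n a}
    (ω : Fin n → Fin (k * rate k n) → Bool) {T : ℕ} {o : Fin n → Estimate}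
    (h : Computes N.graph T (fun v => nodeProg k a c n (N.ident v) (ω v)) o) (v : Fin n) :
    (distanceAlgorithm k a c).outputAt N ω T v = some (o v) := by
  have hrun := progAlgorithm_run (fun n => (exists_encoding k a n).choose_spec)
    (P := fun n => nodeProg k a c n) N ω T
  rw [h.iterate_round] at hrun
  unfold Algorithm.outputAt distanceAlgorithm
  rw [hrun]
  rfl

theorem distanceAlgorithm_haltsWithin (hk : 1 ≤ k) (N : Network n a) :
    (distanceAlgorithm k a c).HaltsWithin N
      (timeConst k c * ((n : ℝ) ^ (1 / ((k : ℝ) + 1)) + N.graph.diam) * (1 + Real.log n) ^ 2) := by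
  obtain ⟨j, hj, h⟩ := computes_nodeProg (c := c) hk N
  have hD : N.graph.diam ≤ n := by
    have := N.connected.nonempty
    obtain ⟨x, y, hxy⟩ := SimpleGraph.exists_dist_eq_diam (G := N.graph)
    exact hxy ▸ (dist_lt_card N.connected x y).le
  refine ⟨_, rounds_le (k := k) (c := c) (one_le_of_network N) hD hj, fun ω v => ?_⟩
  obtain ⟨o, ho, -⟩ := h ω
  exact ⟨o v, distanceAlgorithm_outputAt ω ho v⟩

theorem distanceAlgorithm_prob (hk : 1 ≤ k) (N : Network n a) :
    1 - 1 / (n : ℝ) ^ c ≤ (distanceAlgorithm k a c).prob {ω |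
      Succeeds (distanceAlgorithm k a c) N ω (2 - 1 / 2 ^ k) (3 - 4 / (2 ^ k + 1)) 3} := by
  classical
  obtain ⟨j, -, h⟩ := computes_nodeProg (c := c) hk N
  have hn := one_le_of_network N
  set Ω := Fin n → Fin (k * rate k n) → Bool
  set Good : Set Ω :=
    {ω | GoodSample k (rate k n) (slack k c n) (k * rate k n) (balls N.graph) ω}
  have hsub : Good ⊆ {ω | Succeeds (distanceAlgorithm k a c) N ω (2 - 1 / 2 ^ k)
      (3 - 4 / (2 ^ k + 1)) 3} := by
    intro ω hω
    obtain ⟨o, ho, hgood⟩ := h ω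
    obtain ⟨d, r, e, hout, hrest⟩ := hgood hω
    exact ⟨d, r, e, fun v => ⟨_, hout v ▸ distanceAlgorithm_outputAt ω ho v⟩, hrest⟩
  have hbad := card_not_goodSample (V := Fin n) k (rate k n) (slack k c n) (balls N.graph)
  have hcount : (Good.ncard : ℝ) + (Finset.univ.filter fun ω : Ω =>
      ¬ GoodSample k (rate k n) (slack k c n) (k * rate k n) (balls N.graph) ω).card =
      Fintype.card Ω := by
    have h1 : Good.ncard = (Finset.univ.filter fun ω : Ω =>
        GoodSample k (rate k n) (slack k c n) (k * rate k n) (balls N.graph) ω).card := by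
      rw [← Set.ncard_coe_finset]
      congr 1
      ext ω
      simp [Good]
    rw [h1]
    exact_mod_cast Finset.card_filter_add_card_filter_not (s := (Finset.univ : Finset Ω))
      fun ω : Ω => GoodSample k (rate k n) (slack k c n) (k * rate k n) (balls N.graph) ω
  have hΩ : (0 : ℝ) < Fintype.card Ω := by exact_mod_cast Fintype.card_pos
  have hfail := failure_le (k := k) (c := c) hn
  have hnc : (0 : ℝ) < (n : ℝ) ^ c := by positivity
  have hbad' : ((Finset.univ.filter fun ω : Ω =>
      ¬ GoodSample k (rate k n) (slack k c n) (k * rate k n) (balls N.graph) ω).card : ℝ) ≤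
      Fintype.card Ω / n ^ c := by
    rw [le_div_iff₀ hnc]
    refine le_of_mul_le_mul_right ?_ (show (0 : ℝ) < 2 ^ slack k c n by positivity)
    rw [Fintype.card_prod, Fintype.card_fin, Fintype.card_fin] at hbad
    push_cast at hbad
    calc _ = _ * (2 : ℝ) ^ slack k c n * n ^ c := by ring
      _ ≤ (n * (n + 1) * (k + 1) * 2 * Fintype.card Ω) * n ^ c := by gcongr
      _ = Fintype.card Ω * ((n : ℝ) * (n + 1) * (k + 1) * 2 * n ^ c) := by ring
      _ ≤ _ := by gcongr
  unfold Algorithm.prob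
  have hle := Set.ncard_le_ncard hsub (Set.toFinite _)
  change _ ≤ _ / (Nat.card Ω : ℝ)
  rw [Nat.card_eq_fintype_card, le_div_iff₀ hΩ]
  calc (1 - 1 / (n : ℝ) ^ c) * Fintype.card Ω = Fintype.card Ω - Fintype.card Ω / n ^ c := by ring
    _ ≤ (Good.ncard : ℝ) := by linarith
    _ ≤ _ := by exact_mod_cast hle

end Main

end Congest

theorem mainTheorem3 :
    ∃ κ : ℕ, ∀ k : ℕ, 1 ≤ k → ∀ a c : ℕ,
      ∃ (A : Congest.Algorithm Congest.Estimate) (C e : ℕ),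
        ∀ (n : ℕ) (N : Congest.Network n a),
          A.HaltsWithin N
            (C * ((n : ℝ) ^ (1 / ((k : ℝ) + 1)) + N.graph.diam) * (1 + Real.log n) ^ e) ∧
          1 - 1 / (n : ℝ) ^ c ≤
            A.prob {ω : A.Coins n |
              Congest.Succeeds A N ω (2 - 1 / 2 ^ k) (3 - 4 / (2 ^ k + 1)) κ} := by
  refine ⟨3, fun k hk a c => ⟨Congest.distanceAlgorithm k a c, Congest.timeConst k c, 2,
    fun n N => ⟨Congest.distanceAlgorithm_haltsWithin hk N, ?_⟩⟩⟩
  exact_mod_cast Congest.distanceAlgorithm_prob (c := c) hk N
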